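/- For strings $s,\bar s$ let $\mathrm{ed}(\bar s,s)$ denote their edit distance, i.e. the minimum number of single-character insertions, deletions and substitutions that transform one string into the other. In the asymmetric streaming model the input consists of two strings $\bar s$ (offline) and $s$ (online) of the same length $n$ over an alphabet of $\sigma$ characters; the algorithm is given $n$, may query any character of $\bar s$ at any time (random access), and receives the characters of $s$ one after the other in a single pass. Its memory is the maximum, over all moments of the run, of the number of bits it stores (the input strings themselves are not counted). Formally, an algorithm is a fixed program for a register machine with finitely many registers holding natural numbers, with the operations: assign a constant, add, subtract (truncated at $0$), multiply, divide with rounding down, test for zero, query a character of $\bar s$, and read the next character of $s$; the memory in use is the total binary length of all registers. Theorem. There are absolute constants $K_1,K_2,e$ such that for every real $\delta>0$ there is a deterministic single-pass algorithm in the asymmetric streaming model, one and the same for all $n$, all alphabets and all inputs, with the following properties for all strings $\bar s,s$ of equal length $n$ over an alphabet of size $\sigma$. It halts and outputs a natural number $d$ with $$\mathrm{ed}(\bar s,s)\;\le\; d\;\le\; K_1\,2^{1/\delta}\,\mathrm{ed}(\bar s,s),$$ and, if $n\ge 2$, it uses at most $$K_2\cdot\frac{n^{\delta}}{\delta}\cdot(\log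 n)^{e}\cdot\log_2(\sigma+1)$$ bits of memory. That is, it finds an $O(2^{1/\delta})$-approximation of the edit distance with $\tilde O(n^\delta/\delta)$ memory (for alphabets of size polynomial in $n$ the last factor is absorbed by $\tilde O$). -/

import Mathlib

namespace AsymStream

/-- Elementary instructions of a register machine whose registers, named by `V`, hold natural
numbers. Besides arithmetic, an instruction can query one character of the offline string
(random access) or read the next character of the online string (single pass). -/
inductive Instr (V : Type) : Type
  /-- `x := c`, for a constant `c` of the program -/
  | const (x : V) (c : ℕ)
  /-- `x := y + z` -/
  | add (x y z : V)
  /-- `x := y - z`, truncated at `0` -/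
  | sub (x y z : V)
  /-- `x := y * z` -/
  | mul (x y z : V)
  /-- `x := ⌊y / z⌋`, and `0` if `z = 0` -/
  | div (x y z : V)
  /-- `x :=` the code of the character of the offline string at the (0-based) position `y` -/
  | query (x y : V)
  /-- `x :=` the code of the next character of the online string, which is thereby consumed -/
  | read (x : V)

/-- Deterministic programs over the elementary instructions. -/
inductive Prog (V : Type) : Type
  | instr (a : Instr V)
  /-- run `p`, then `q` -/
  | seq (p q : Prog V)
  /-- `if x ≠ 0 then p else q` -/
  | ite (x : V) (p q : Prog V)
  /-- `while x ≠ 0 do p` -/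
  | loop (x : V) (p : Prog V)

/-- The code of a character that may be absent: `0` stands for "no character" (past the end of
the string), and `a + 1` for the character `a`. -/
def charCode {σ : ℕ} : Option (Fin σ) → ℕ
  | none => 0
  | some a => (a : ℕ) + 1

/-- What changes during a run over strings with characters in `Fin σ`: the memory of the
algorithm, and the part of the online string that has not arrived yet. -/
structure Config (V : Type) (σ : ℕ) where
  /-- contents of the registers -/
  mem : V → ℕ
  /-- the part of the online string that has not been read -/
  stream : List (Fin σ)

section Semantics

variable {V : Type} [Fintype V] [DecidableEq V] {σ : ℕ}

/-- The memory in use, in bits: the total length of the binary expansions of all registers.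
(The arithmetic instructions can be executed by a Turing machine in space linear in the length
of their operands and result, so up to a constant factor this is work-tape space.) -/
def Config.bits (c : Config V σ) : ℕ := ∑ x, Nat.size (c.mem x)

/-- Overwrite one register. -/
def Config.set (c : Config V σ) (x : V) (v : ℕ) : Config V σ :=
  ⟨Function.update c.mem x v, c.stream⟩

/-- The effect of one instruction, for the offline string `offline`. -/
def Instr.step (offline : List (Fin σ)) : Instr V → Config V σ → Config V σ
  | .const x k, c => c.set x k
  | .add x y z, c => c.set x (c.mem y + c.mem z)
  | .sub x y z, c => c.set x (c.mem y - c.mem z)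
  | .mul x y z, c => c.set x (c.mem y * c.mem z)
  | .div x y z, c => c.set x (c.mem y / c.mem z)
  | .query x y, c => c.set x (charCode offline[c.mem y]?)
  | .read x, c => ⟨Function.update c.mem x (charCode c.stream.head?), c.stream.tail⟩

/-- `Exec offline b p c c'`: with offline string `offline`, the run of `p` from the
configuration `c` halts, in the configuration `c'`, and at every moment of this run (including
its beginning and its end) at most `b` bits of memory are in use. -/
inductive Exec (offline : List (Fin σ)) (b : ℕ) : Prog V → Config V σ → Config V σ → Prop
  | instr (a : Instr V) (c : Config V σ) :
      c.bits ≤ b → (a.step offline c).bits ≤ b →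
      Exec offline b (.instr a) c (a.step offline c)
  | seq (p q : Prog V) (c c' c'' : Config V σ) :
      Exec offline b p c c' → Exec offline b q c' c'' → Exec offline b (.seq p q) c c''
  | ite_true (x : V) (p q : Prog V) (c c' : Config V σ) :
      c.mem x ≠ 0 → Exec offline b p c c' → Exec offline b (.ite x p q) c c'
  | ite_false (x : V) (p q : Prog V) (c c' : Config V σ) :
      c.mem x = 0 → Exec offline b q c c' → Exec offline b (.ite x p q) c c'
  | loop_true (x : V) (p : Prog V) (c c' c'' : Config V σ) :
      c.mem x ≠ 0 → Exec offline b p c c' → Exec offline b (.loop x p) c' c'' →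
      Exec offline b (.loop x p) c c''
  | loop_false (x : V) (p : Prog V) (c : Config V σ) :
      c.mem x = 0 → c.bits ≤ b → Exec offline b (.loop x p) c c

end Semantics

/-- A deterministic single-pass algorithm in the asymmetric streaming model: one program, with
finitely many registers, for all lengths, alphabets and inputs. -/
structure Algorithm where
  /-- names of the registers -/
  V : Type
  /-- there are finitely many registers -/
  [fintype : Fintype V]
  /-- names of registers can be compared -/
  [decEq : DecidableEq V]
  /-- the register that initially holds the length of the strings -/
  input : V
  /-- the register that holds the answer when the program halts -/
  output : V
  /-- the program -/
  code : Prog V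

attribute [instance] Algorithm.fintype Algorithm.decEq

/-- The initial configuration: the length `n` in the input register, `0` in all other registers,
and the whole online string still to arrive. -/
def Algorithm.init (A : Algorithm) {σ : ℕ} (n : ℕ) (online : List (Fin σ)) : Config A.V σ :=
  ⟨Function.update (fun _ => 0) A.input n, online⟩

/-- On strings `offline` and `online` of length `n`, the algorithm halts with answer `d`, and never
uses more than `b` bits of memory. -/
def Algorithm.Returns (A : Algorithm) {σ : ℕ} (n : ℕ) (offline online : List (Fin σ))
    (b d : ℕ) : Prop :=
  ∃ c : Config A.V σ, Exec offline b A.code (A.init n online) c ∧ c.mem A.output = d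

/-- One edit operation on a string: insertion, deletion or substitution of one character. -/
inductive EditStep {α : Type} : List α → List α → Prop
  | insertion (u v : List α) (a : α) : EditStep (u ++ v) (u ++ a :: v)
  | deletion (u v : List α) (a : α) : EditStep (u ++ a :: v) (u ++ v)
  | substitution (u v : List α) (a b : α) : EditStep (u ++ a :: v) (u ++ b :: v)

/-- `EditsTo k s t`: a sequence of `k` edit operations transforms `s` into `t`. -/
inductive EditsTo {α : Type} : ℕ → List α → List α → Prop
  | refl (s : List α) : EditsTo 0 s s
  | tail (k : ℕ) (s t u : List α) : EditsTo k s t → EditStep t u → EditsTo (k + 1) s u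

/-- The edit distance: the least number of insertions, deletions and substitutions of single
characters that transform one string into the other. (Such a transformation always exists.) -/
noncomputable def ed {α : Type} (s t : List α) : ℕ := sInf {k | EditsTo k s t}

end AsymStream

/-! Put `k = ⌈1/δ⌉` and let `B ≥ 2` be least with `n ≤ B ^ k`. The online string is cut
hierarchically into blocks of `B ^ j` characters, and a complete block is remembered only through a
substring of the offline string, that is, through two positions. A single character is represented
by an equal offline character, or by the empty substring at cost 1. Once `B` blocks of level `j` are
complete, they are replaced by an offline substring nearest to the concatenation of their
representatives. All distances paid are added up in `E`. At the end the distance from the offline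
string to the concatenation of the remaining representatives is added to `E`, which is the output.

The output is an upper bound by the triangle inequality. For the approximation factor, suppose that
the total cost `e` paid for a string `x` satisfies `e ≤ K * ed u x` for every offline substring `u`.
Concatenation preserves this property with the same `K`, because an optimal alignment of `u` with `x
++ y` splits `u` (`ed_sub_split`, `Rep.opt`). A merge pays at most `ed u x + e` more, so `K` becomes
`2 * K + 1` (`Rep.merge`). Hence level `j` has factor `2 ^ (j + 1) - 1`, and the final comparison
costs one more such step, giving `2 ^ (k + 2) - 1 ≤ 8 * 2 ^ (1 / δ)`.

At most `(k + 1) * B` pairs of positions are stored. Distances to strings that exist only as lists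
of offline substrings are computed in polylogarithmic extra space by a recursion in the style of
Savitch: halve the second string, try every cut of the first, and recurse to depth `O(log n)`
(`exists_returned`). Running time plays no role. Both stacks are packed into single registers as
numbers in a base `Q` of order `n ^ 2`.

The program is written in a small structured language, verified with weakest preconditions that also
bound every assigned value by `M`, and compiled to the register machine (`Big.exec_compile`). The
bit bound then follows from the size of `M` and the fixed number of registers. -/

namespace AsymStream

/-! ### Edit distance: triangle inequality, splitting, distance to a single character. -/

section EditDistance

variable {α : Type}

theorem EditStep.symm {s t : List α} (h : EditStep s t) : EditStep t s := by
  cases h with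
  | insertion u v a => exact .deletion u v a
  | deletion u v a => exact .insertion u v a
  | substitution u v a b => exact .substitution u v b a

theorem EditStep.append_left (w : List α) {s t : List α} (h : EditStep s t) :
    EditStep (w ++ s) (w ++ t) := by
  cases h with
  | insertion u v a => simpa using EditStep.insertion (w ++ u) v a
  | deletion u v a => simpa using EditStep.deletion (w ++ u) v a
  | substitution u v a b => simpa using EditStep.substitution (w ++ u) v a b

theorem EditStep.append_right (w : List α) {s t : List α} (h : EditStep s t) :
    EditStep (s ++ w) (t ++ w) := by
  cases h with
  | insertion u v a => simpa using EditStep.insertion u (v ++ w) a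
  | deletion u v a => simpa using EditStep.deletion u (v ++ w) a
  | substitution u v a b => simpa using EditStep.substitution u (v ++ w) a b

theorem EditsTo.trans {j k : ℕ} {s t u : List α} (h : EditsTo j s t) (h' : EditsTo k t u) :
    EditsTo (j + k) s u := by
  induction h' with
  | refl => exact h
  | tail k a b c _ hs ih => exact .tail (j + k) _ _ _ (ih h) hs

theorem EditStep.editsTo {s t : List α} (h : EditStep s t) : EditsTo 1 s t :=
  .tail 0 _ _ _ (.refl s) h

theorem EditsTo.symm {k : ℕ} {s t : List α} (h : EditsTo k s t) : EditsTo k t s := by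
  induction h with
  | refl => exact .refl _
  | tail k a b c _ hs ih => exact add_comm 1 k ▸ hs.symm.editsTo.trans ih

theorem EditsTo.append_left (w : List α) {k : ℕ} {s t : List α} (h : EditsTo k s t) :
    EditsTo k (w ++ s) (w ++ t) := by
  induction h with
  | refl => exact .refl _
  | tail k a b c _ hs ih => exact .tail k _ _ _ ih (hs.append_left w)

theorem EditsTo.append_right (w : List α) {k : ℕ} {s t : List α} (h : EditsTo k s t) :
    EditsTo k (s ++ w) (t ++ w) := by
  induction h with
  | refl => exact .refl _
  | tail k a b c _ hs ih => exact .tail k _ _ _ ih (hs.append_right w)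

theorem EditsTo.append {j k : ℕ} {s t s' t' : List α} (h : EditsTo j s t)
    (h' : EditsTo k s' t') : EditsTo (j + k) (s ++ s') (t ++ t') :=
  (h.append_right s').trans (h'.append_left t)

theorem editsTo_nil (s : List α) : EditsTo s.length s [] := by
  induction s with
  | nil => exact .refl _
  | cons a s ih =>
    have := (EditStep.deletion [] s a).editsTo.trans ih
    simpa [add_comm] using this

theorem exists_editsTo (s t : List α) : ∃ k, EditsTo k s t :=
  ⟨_, (editsTo_nil s).trans (editsTo_nil t).symm⟩

theorem editsTo_ed (s t : List α) : EditsTo (ed s t) s t :=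
  Nat.sInf_mem (s := {k | EditsTo k s t}) (exists_editsTo s t)

theorem EditsTo.ed_le {k : ℕ} {s t : List α} (h : EditsTo k s t) : ed s t ≤ k := Nat.sInf_le h

theorem ed_comm (s t : List α) : ed s t = ed t s :=
  le_antisymm (editsTo_ed t s).symm.ed_le (editsTo_ed s t).symm.ed_le

theorem ed_triangle (s t u : List α) : ed s u ≤ ed s t + ed t u :=
  ((editsTo_ed s t).trans (editsTo_ed t u)).ed_le

theorem ed_append_le (s t s' t' : List α) : ed (s ++ s') (t ++ t') ≤ ed s t + ed s' t' :=
  ((editsTo_ed s t).append (editsTo_ed s' t')).ed_le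

theorem ed_self (s : List α) : ed s s = 0 := Nat.le_zero.1 (EditsTo.refl s).ed_le

/-- An edit operation on a concatenation acts on one of the two parts. -/
theorem EditStep.split {s t t₁ t₂ : List α} (h : EditStep s t) (ht : t = t₁ ++ t₂) :
    (∃ s₁, s = s₁ ++ t₂ ∧ EditStep s₁ t₁) ∨ ∃ s₂, s = t₁ ++ s₂ ∧ EditStep s₂ t₂ := by
  cases h with
  | insertion u v a =>
    rcases List.append_eq_append_iff.1 ht with ⟨w, rfl, hw⟩ | ⟨w, rfl, rfl⟩
    · rcases List.cons_eq_append_iff.1 hw with ⟨rfl, rfl⟩ | ⟨w, rfl, rfl⟩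
      · exact .inr ⟨v, by simp, .insertion [] v a⟩
      · exact .inl ⟨u ++ w, by simp, .insertion u w a⟩
    · exact .inr ⟨w ++ v, by simp, .insertion w v a⟩
  | deletion u v a =>
    rcases List.append_eq_append_iff.1 ht with ⟨w, rfl, rfl⟩ | ⟨w, rfl, rfl⟩
    · exact .inl ⟨u ++ a :: w, by simp, .deletion u w a⟩
    · exact .inr ⟨w ++ a :: v, by simp, .deletion w v a⟩
  | substitution u v a b =>
    rcases List.append_eq_append_iff.1 ht with ⟨w, rfl, hw⟩ | ⟨w, rfl, rfl⟩
    · rcases List.cons_eq_append_iff.1 hw with ⟨rfl, rfl⟩ | ⟨w, rfl, rfl⟩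
      · exact .inr ⟨a :: v, by simp, .substitution [] v a b⟩
      · exact .inl ⟨u ++ a :: w, by simp, .substitution u w a b⟩
    · exact .inr ⟨w ++ a :: v, by simp, .substitution w v a b⟩

/-- The last operation falls into one part of the target; undoing it carries the cut back to the
previous string, and the operations of the two parts are counted separately. -/
theorem EditsTo.split {k : ℕ} {s t : List α} (h : EditsTo k s t) :
    ∀ t₁ t₂, t = t₁ ++ t₂ → ∃ s₁ s₂ k₁ k₂, s = s₁ ++ s₂ ∧ k = k₁ + k₂ ∧
      EditsTo k₁ s₁ t₁ ∧ EditsTo k₂ s₂ t₂ := by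
  induction h with
  | refl s => exact fun t₁ t₂ h => ⟨t₁, t₂, 0, 0, h, rfl, .refl _, .refl _⟩
  | tail k a b c _ hs ih =>
    intro t₁ t₂ ht
    rcases hs.split ht with ⟨b₁, hb, h1⟩ | ⟨b₂, hb, h2⟩
    · obtain ⟨s₁, s₂, k₁, k₂, rfl, rfl, e1, e2⟩ := ih _ _ hb
      exact ⟨s₁, s₂, k₁ + 1, k₂, rfl, by omega, .tail _ _ _ _ e1 h1, e2⟩
    · obtain ⟨s₁, s₂, k₁, k₂, rfl, rfl, e1, e2⟩ := ih _ _ hb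
      exact ⟨s₁, s₂, k₁, k₂ + 1, rfl, by omega, e1, .tail _ _ _ _ e2 h2⟩

/-- An optimal transformation into a concatenation splits the source string. -/
theorem ed_split (s t₁ t₂ : List α) :
    ∃ s₁ s₂, s = s₁ ++ s₂ ∧ ed s₁ t₁ + ed s₂ t₂ ≤ ed s (t₁ ++ t₂) := by
  obtain ⟨s₁, s₂, k₁, k₂, hs, hk, e1, e2⟩ := (editsTo_ed s (t₁ ++ t₂)).split _ _ rfl
  exact ⟨s₁, s₂, hs, by have := e1.ed_le; have := e2.ed_le; omega⟩

/-- One operation changes the number of characters of a given kind by at most one. This is the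
source of all lower bounds on `ed` below. -/
theorem EditsTo.countP_le (p : α → Bool) {k : ℕ} {s t : List α} (h : EditsTo k s t) :
    s.countP p ≤ t.countP p + k := by
  induction h with
  | refl => simp
  | tail k a b c _ hs ih =>
    refine ih.trans ?_
    cases hs with
    | insertion u v a => simp [List.countP_append, List.countP_cons]; omega
    | deletion u v a => simp [List.countP_append, List.countP_cons]; split_ifs <;> omega
    | substitution u v a b =>
      simp [List.countP_append, List.countP_cons]; split_ifs <;> omega

theorem countP_le_ed (p : α → Bool) (s t : List α) : s.countP p ≤ t.countP p + ed s t :=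
  (editsTo_ed s t).countP_le p

theorem length_le_ed (s t : List α) : s.length ≤ t.length + ed s t := by
  simpa using countP_le_ed (fun _ => true) s t

theorem ed_nil (s : List α) : ed s [] = s.length :=
  le_antisymm (editsTo_nil s).ed_le (by simpa using length_le_ed s [])

theorem ed_le_length_add (s t : List α) : ed s t ≤ s.length + t.length := by
  have := ed_triangle s [] t
  rwa [ed_comm [] t, ed_nil, ed_nil] at this

theorem ed_le_max_length (s t : List α) : ed s t ≤ max s.length t.length := by
  induction s generalizing t with
  | nil => rw [ed_comm, ed_nil]; simp
  | cons a s ih =>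
    cases t with
    | nil => rw [ed_nil]; simp
    | cons b t =>
      have h1 := ed_append_le [a] [b] s t
      have h2 := (EditStep.substitution [] [] a b).editsTo.ed_le
      have h3 := ih t
      simp at h1 h2 ⊢
      omega

theorem ed_singleton_of_mem {s : List α} {a : α} (h : a ∈ s) : ed s [a] = s.length - 1 := by
  refine le_antisymm ?_ (by have := length_le_ed s [a]; simp at this; omega)
  obtain ⟨u, v, rfl⟩ := List.append_of_mem h
  have h1 := ed_append_le u [] ([a] ++ v) [a]
  have h2 := ed_append_le [a] [a] v []
  rw [ed_nil] at h1 h2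
  rw [ed_self] at h2
  simp at h1 h2 ⊢
  omega

/-- Counting the characters different from `a` gives the lower bound `s.length`; the maximum with 1
matters only for `s = []`. -/
theorem ed_singleton_of_not_mem {s : List α} {a : α} (h : a ∉ s) :
    ed s [a] = max s.length 1 := by
  classical
  refine le_antisymm (by simpa using ed_le_max_length s [a]) (max_le ?_ ?_)
  · have h1 := countP_le_ed (fun b => b ≠ a) s [a]
    rw [List.countP_eq_length.2 (fun b hb => by
      simpa using fun e : b = a => h (e ▸ hb))] at h1
    simpa using h1
  · by_contra h0
    have h1 := length_le_ed s [a]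
    have h2 := length_le_ed [a] s
    rw [ed_comm] at h2
    have h3 := editsTo_ed s [a]
    rw [show ed s [a] = 0 by omega] at h3
    cases h3
    simp at h

end EditDistance

/-! ### Substrings given by two positions. -/

/-- The substring of `s` from position `l` (included) to position `r` (excluded). -/
def sub {α : Type} (s : List α) (l r : ℕ) : List α := (s.take r).drop l

section Substring

variable {α : Type} (s : List α)

theorem length_sub (l r : ℕ) (h : r ≤ s.length) : (sub s l r).length = r - l := by
  simp [sub, h]

theorem sub_append {l m r : ℕ} (h1 : l ≤ m) (h2 : m ≤ r) :
    sub s l m ++ sub s m r = sub s l r := by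
  unfold sub
  have h : s.take m = (s.take r).take m := by rw [List.take_take, min_eq_left h2]
  rw [h]
  obtain ⟨d, rfl⟩ := Nat.exists_eq_add_of_le h1
  rw [List.drop_take, Nat.add_sub_cancel_left, ← List.drop_drop, List.take_append_drop]

theorem sub_self (l : ℕ) : sub s l l = [] := by simp [sub]

theorem sub_zero_length : sub s 0 s.length = s := by simp [sub]

theorem exists_sub_of_append {l r : ℕ} (hl : l ≤ r) (hr : r ≤ s.length) {u v : List α}
    (h : sub s l r = u ++ v) : ∃ m, l ≤ m ∧ m ≤ r ∧ u = sub s l m ∧ v = sub s m r := by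
  have hlen := congrArg List.length h
  rw [length_sub s l r hr, List.length_append] at hlen
  refine ⟨l + u.length, by omega, by omega, ?_⟩
  have h1 := sub_append s (l := l) (m := l + u.length) (r := r) (by omega) (by omega)
  rw [h] at h1
  have := List.append_inj h1 (by rw [length_sub s _ _ (by omega)]; omega)
  exact ⟨this.1.symm, this.2.symm⟩

theorem mem_sub {l r : ℕ} {a : α} : a ∈ sub s l r ↔ ∃ i, l ≤ i ∧ i < r ∧ s[i]? = some a := by
  rw [List.mem_iff_getElem?]
  simp only [sub, List.getElem?_drop, List.getElem?_take]
  constructor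
  · rintro ⟨i, hi⟩
    split_ifs at hi with h
    exact ⟨l + i, by omega, h, hi⟩
  · rintro ⟨i, h1, h2, h3⟩
    exact ⟨i - l, by rw [show l + (i - l) = i by omega, if_pos h2, h3]⟩

/-- Used twice: it makes the divide-and-conquer evaluation exact, and it shows that concatenation
does not worsen the approximation factor. -/
theorem ed_sub_split {l r : ℕ} (hl : l ≤ r) (hr : r ≤ s.length) (t₁ t₂ : List α) :
    ∃ m, l ≤ m ∧ m ≤ r ∧
      ed (sub s l m) t₁ + ed (sub s m r) t₂ ≤ ed (sub s l r) (t₁ ++ t₂) := by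
  obtain ⟨s₁, s₂, h, hle⟩ := ed_split (sub s l r) t₁ t₂
  obtain ⟨m, h1, h2, rfl, rfl⟩ := exists_sub_of_append s hl hr h
  exact ⟨m, h1, h2, hle⟩

theorem sub_succ {i : ℕ} {a : α} (h : s[i]? = some a) : sub s i (i + 1) = [a] := by
  obtain ⟨hi, rfl⟩ := List.getElem?_eq_some_iff.1 h
  rw [sub, List.take_add_one, List.getElem?_eq_getElem hi, List.drop_append_of_le_length (by simp; omega)]
  simp

end Substring

/-! ### A structured language with bounded values. -/

/-- Arithmetic expressions over registers, with queries to the offline string. -/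
inductive Expr (V : Type) : Type
  | var (x : V)
  | const (k : ℕ)
  | add (a b : Expr V)
  | sub (a b : Expr V)
  | mul (a b : Expr V)
  | div (a b : Expr V)
  | query (a : Expr V)

/-- Structured commands whose assignments and tests use expressions. -/
inductive Cmd (V : Type) : Type
  | skip
  | assign (x : V) (e : Expr V)
  | read (x : V)
  | seq (p q : Cmd V)
  | ite (e : Expr V) (p q : Cmd V)
  | while (e : Expr V) (p : Cmd V)

section Language

variable {V : Type} {σ : ℕ}

/-- The value of an expression. -/
def Expr.eval (off : List (Fin σ)) (m : V → ℕ) : Expr V → ℕ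
  | .var x => m x
  | .const k => k
  | .add a b => a.eval off m + b.eval off m
  | .sub a b => a.eval off m - b.eval off m
  | .mul a b => a.eval off m * b.eval off m
  | .div a b => a.eval off m / b.eval off m
  | .query a => charCode off[a.eval off m]?

/-- The number of leaves of an expression. -/
def Expr.size : Expr V → ℕ
  | .var _ => 1
  | .const _ => 1
  | .add a b => a.size + b.size
  | .sub a b => a.size + b.size
  | .mul a b => a.size + b.size
  | .div a b => a.size + b.size
  | .query a => a.size

/-- All constants of the expression are less than `M`. -/
def Expr.ConstLT (M : ℕ) : Expr V → Prop
  | .var _ => True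
  | .const k => k < M
  | .add a b => a.ConstLT M ∧ b.ConstLT M
  | .sub a b => a.ConstLT M ∧ b.ConstLT M
  | .mul a b => a.ConstLT M ∧ b.ConstLT M
  | .div a b => a.ConstLT M ∧ b.ConstLT M
  | .query a => a.ConstLT M

/-- All expressions of the command have size at most `S` and constants less than `M`. -/
def Cmd.Fits (S M : ℕ) : Cmd V → Prop
  | .skip => True
  | .assign _ e => e.size ≤ S ∧ e.ConstLT M
  | .read _ => True
  | .seq p q => p.Fits S M ∧ q.Fits S M
  | .ite e p q => (e.size ≤ S ∧ e.ConstLT M) ∧ p.Fits S M ∧ q.Fits S M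
  | .while e p => (e.size ≤ S ∧ e.ConstLT M) ∧ p.Fits S M

theorem charCode_le (a : Option (Fin σ)) : charCode a ≤ σ := by
  cases a with
  | none => simp [charCode]
  | some a => exact a.2

theorem Expr.size_pos (e : Expr V) : 1 ≤ e.size := by
  induction e <;> simp only [Expr.size] <;> omega

/-- Each leaf contributes a factor `M`: products multiply the bounds, and sums are dominated by
products of the bounds since these are at least 2. So all intermediate values fit once `M ^ S` does.
-/
theorem Expr.eval_lt {off : List (Fin σ)} {m : V → ℕ} {M : ℕ} (hM : 2 ≤ M) (hσ : σ < M)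
    (hm : ∀ x, m x < M) (e : Expr V) (he : e.ConstLT M) : e.eval off m < M ^ e.size := by
  have hadd : ∀ {x y p q : ℕ}, x < M ^ p → y < M ^ q → 1 ≤ p → 1 ≤ q → x + y < M ^ (p + q) := by
    intro x y p q hx hy hp hq
    have h1 : 2 ≤ M ^ p := hM.trans (Nat.le_self_pow (by omega) M)
    have h2 : 2 ≤ M ^ q := hM.trans (Nat.le_self_pow (by omega) M)
    rw [pow_add]
    nlinarith
  have hle : ∀ p q : ℕ, M ^ p ≤ M ^ (p + q) := fun p q =>
    Nat.pow_le_pow_right (by omega) (by omega)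
  induction e with
  | var x => simpa [Expr.eval, Expr.size] using hm x
  | const k => simpa only [Expr.eval, Expr.size, pow_one, Expr.ConstLT] using he
  | add a b iha ihb => exact hadd (iha he.1) (ihb he.2) a.size_pos b.size_pos
  | sub a b iha ihb => exact (Nat.sub_le _ _).trans_lt ((iha he.1).trans_le (hle _ _))
  | mul a b iha ihb =>
    simp only [Expr.eval, Expr.size, pow_add]
    exact Nat.mul_lt_mul'' (iha he.1) (ihb he.2)
  | div a b iha ihb => exact (Nat.div_le_self _ _).trans_lt ((iha he.1).trans_le (hle _ _))
  | query a iha =>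
    exact ((charCode_le _).trans_lt hσ).trans_le (Nat.le_self_pow (by have := a.size_pos; simp [Expr.size]; omega) M)

variable [DecidableEq V]

/-- `Big off M p c c'`: the command `p` takes `c` to `c'`, and assigns only values less than `M`. -/
inductive Big (off : List (Fin σ)) (M : ℕ) : Cmd V → Config V σ → Config V σ → Prop
  | skip (c) : Big off M .skip c c
  | assign (x e c) : e.eval off c.mem < M → Big off M (.assign x e) c (c.set x (e.eval off c.mem))
  | read (x c) : Big off M (.read x) c
      ⟨Function.update c.mem x (charCode c.stream.head?), c.stream.tail⟩
  | seq (p q c c' c'') : Big off M p c c' → Big off M q c' c'' → Big off M (.seq p q) c c''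
  | ite_true (e p q c c') : e.eval off c.mem ≠ 0 → Big off M p c c' → Big off M (.ite e p q) c c'
  | ite_false (e p q c c') : e.eval off c.mem = 0 → Big off M q c c' → Big off M (.ite e p q) c c'
  | while_true (e p c c' c'') : e.eval off c.mem ≠ 0 → Big off M p c c' →
      Big off M (.while e p) c' c'' → Big off M (.while e p) c c''
  | while_false (e p c) : e.eval off c.mem = 0 → Big off M (.while e p) c c

end Language

/-! ### Compilation to the register machine. -/

section Compilation

variable {V : Type} {σ : ℕ} (S : ℕ)

/-- The `t`-th scratch register. -/
def tmp (t : ℕ) : V ⊕ Fin (S + 1) := .inr (Fin.ofNat (S + 1) t)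

/-- Evaluate an expression into the `t`-th scratch register. -/
def Expr.compile : Expr V → ℕ → Prog (V ⊕ Fin (S + 1))
  | .var x, t => .seq (.instr (.const (tmp S t) 0)) (.instr (.add (tmp S t) (tmp S t) (.inl x)))
  | .const k, t => .instr (.const (tmp S t) k)
  | .add a b, t => .seq (a.compile t) (.seq (b.compile (t + 1))
      (.instr (.add (tmp S t) (tmp S t) (tmp S (t + 1)))))
  | .sub a b, t => .seq (a.compile t) (.seq (b.compile (t + 1))
      (.instr (.sub (tmp S t) (tmp S t) (tmp S (t + 1)))))
  | .mul a b, t => .seq (a.compile t) (.seq (b.compile (t + 1))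
      (.instr (.mul (tmp S t) (tmp S t) (tmp S (t + 1)))))
  | .div a b, t => .seq (a.compile t) (.seq (b.compile (t + 1))
      (.instr (.div (tmp S t) (tmp S t) (tmp S (t + 1)))))
  | .query a, t => .seq (a.compile t) (.instr (.query (tmp S t) (tmp S t)))

/-- Translation of structured commands to programs of the register machine. -/
def Cmd.compile : Cmd V → Prog (V ⊕ Fin (S + 1))
  | .skip => .instr (.const (tmp S 0) 0)
  | .assign x e => .seq (e.compile S 0)
      (.seq (.instr (.const (.inl x) 0)) (.instr (.add (.inl x) (.inl x) (tmp S 0))))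
  | .read x => .instr (.read (.inl x))
  | .seq p q => .seq p.compile q.compile
  | .ite e p q => .seq (e.compile S 0) (.ite (tmp S 0) p.compile q.compile)
  | .while e p => .seq (e.compile S 0) (.loop (tmp S 0) (.seq p.compile (e.compile S 0)))

/-- Indices are reduced modulo `S + 1`, so the upper bound on `t'` excludes a wrap-around. -/
theorem tmp_ne {t t' : ℕ} (h : t < t') (h' : t' ≤ S) : (tmp S t : V ⊕ Fin (S + 1)) ≠ tmp S t' := by
  intro e
  have := congrArg Fin.val (Sum.inr_injective e)
  simp only [Fin.val_ofNat] at this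
  rw [Nat.mod_eq_of_lt (by omega), Nat.mod_eq_of_lt (by omega)] at this
  omega

/-- All registers are less than `M`. -/
def Config.LT (M : ℕ) (c : Config V σ) : Prop := ∀ x, c.mem x < M

theorem Config.LT.bits_le [Fintype V] {L : ℕ} {c : Config V σ} (h : c.LT (2 ^ L)) :
    c.bits ≤ Fintype.card V * L := by
  have : ∀ x ∈ Finset.univ, Nat.size (c.mem x) ≤ L := fun x _ => Nat.size_le.2 (h x)
  simpa [Config.bits] using Finset.sum_le_card_nsmul _ _ _ this

variable [DecidableEq V]

theorem Config.set_mem (c : Config V σ) (x y : V) (v : ℕ) :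
    (c.set x v).mem y = if y = x then v else c.mem y := Function.update_apply _ _ _ _

theorem Config.LT.set {M : ℕ} {c : Config V σ} (h : c.LT M) (x : V) {v : ℕ} (hv : v < M) :
    (c.set x v).LT M := by
  intro y
  rw [Config.set_mem]
  split_ifs
  exacts [hv, h y]

variable [Fintype V] {off : List (Fin σ)} {L : ℕ}

theorem exec_set {W : Type} [Fintype W] [DecidableEq W] {c : Config W σ} (hc : c.LT (2 ^ L))
    (a : Instr W) (x : W) (v : ℕ) (ha : a.step off c = c.set x v) (hv : v < 2 ^ L) :
    Exec off (Fintype.card W * L) (.instr a) c (c.set x v) ∧ (c.set x v).LT (2 ^ L) := by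
  have h := hc.set x hv
  refine ⟨?_, h⟩
  rw [← ha]
  refine .instr a c hc.bits_le ?_
  rw [ha]
  exact h.bits_le

variable {S}

/-- The code of the expression computes its value and preserves everything else except
later scratch registers. -/
def Expr.Compiles (off : List (Fin σ)) (S L M : ℕ) (e : Expr V) : Prop :=
  ∀ (t : ℕ) (d : Config (V ⊕ Fin (S + 1)) σ), e.ConstLT M → t + e.size ≤ S →
    d.LT (2 ^ L) → (∀ x, d.mem (.inl x) < M) →
    ∃ d', Exec off (Fintype.card (V ⊕ Fin (S + 1)) * L) (e.compile S t) d d' ∧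
      d'.mem (tmp S t) = e.eval off (fun x => d.mem (.inl x)) ∧
      (∀ x, d'.mem (.inl x) = d.mem (.inl x)) ∧
      (∀ t' < t, d'.mem (tmp S t') = d.mem (tmp S t')) ∧
      d'.stream = d.stream ∧ d'.LT (2 ^ L)

/-- The scratch registers act as an evaluation stack. Its height never exceeds the number of leaves,
whence the condition `t + e.size ≤ S`. -/
theorem Expr.exec_compile {M : ℕ} (hM : 2 ≤ M) (hσ : σ < M) (hL : M ^ S = 2 ^ L) (e : Expr V) :
    e.Compiles off S L M := by
  have hS : ∀ {v : ℕ} (e : Expr V) (t : ℕ), t + e.size ≤ S → v < M ^ e.size → v < 2 ^ L := by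
    intro v e t ht hv
    rw [← hL]
    exact hv.trans_le (Nat.pow_le_pow_right (by omega) (by omega))
  have hpos : 0 < 2 ^ L := by positivity
  -- The four binary operations share one argument, with `f` the operation and `ins` its
  -- instruction. The second operand is evaluated one register higher, so the first survives.
  have hbin : ∀ (a b ab : Expr V) (ins : ∀ x y z : V ⊕ Fin (S + 1), Instr (V ⊕ Fin (S + 1)))
      (f : ℕ → ℕ → ℕ),
      (∀ x y z (c : Config (V ⊕ Fin (S + 1)) σ), (ins x y z).step off c =
        c.set x (f (c.mem y) (c.mem z))) →
      (∀ t, ab.compile S t = .seq (a.compile S t) (.seq (b.compile S (t + 1))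
        (.instr (ins (tmp S t) (tmp S t) (tmp S (t + 1)))))) →
      (∀ m : V → ℕ, ab.eval off m = f (a.eval off m) (b.eval off m)) →
      ab.size = a.size + b.size → (ab.ConstLT M → a.ConstLT M ∧ b.ConstLT M) →
      a.Compiles off S L M → b.Compiles off S L M → ab.Compiles off S L M := by
    intro a b ab ins f hins hcomp heval hsize hconst iha ihb t d hc ht hd hdM
    have hap := a.size_pos
    have hbp := b.size_pos
    obtain ⟨d1, x1, v1, m1, t1, s1, l1⟩ := iha t d (hconst hc).1 (by omega) hd hdM
    obtain ⟨d2, x2, v2, m2, t2, s2, l2⟩ := ihb (t + 1) d1 (hconst hc).2 (by omega) l1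
      (fun x => by rw [m1]; exact hdM x)
    have hv : f (d2.mem (tmp S t)) (d2.mem (tmp S (t + 1))) =
        ab.eval off (fun x => d.mem (.inl x)) := by
      rw [t2 t (by omega), v1, v2, heval]
      simp only [m1]
    obtain ⟨x3, l3⟩ := exec_set (off := off) l2 (ins (tmp S t) (tmp S t) (tmp S (t + 1)))
      (tmp S t) _ (hins _ _ _ _)
      (by rw [hv]; exact hS ab t ht (ab.eval_lt hM hσ hdM hc))
    refine ⟨_, hcomp t ▸ .seq _ _ _ _ _ x1 (.seq _ _ _ _ _ x2 x3), ?_, ?_, ?_, ?_, l3⟩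
    · rw [Config.set_mem, if_pos rfl, hv]
    · intro x
      rw [Config.set_mem, if_neg (by simp [tmp]), m2, m1]
    · intro t' ht'
      rw [Config.set_mem, if_neg (tmp_ne S ht' (by omega)), t2 _ (by omega), t1 _ ht']
    · exact s2.trans s1
  induction e with
  | var x =>
    intro t d hc ht hd hdM
    obtain ⟨x1, l1⟩ := exec_set (off := off) hd (.const (tmp S t) 0) (tmp S t) 0 rfl hpos
    obtain ⟨x2, l2⟩ := exec_set (off := off) l1 (.add (tmp S t) (tmp S t) (.inl x)) (tmp S t)
      (d.mem (.inl x)) (by simp [Instr.step, Config.set_mem, tmp]) (hd _)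
    refine ⟨_, .seq _ _ _ _ _ x1 x2, ?_, ?_, ?_, rfl, l2⟩
    · simp [Config.set_mem, Expr.eval]
    · intro y
      simp [Config.set_mem, tmp]
    · intro t' ht'
      have := tmp_ne (V := V) S ht' (by simp only [Expr.size] at ht; omega)
      simp [Config.set_mem, this]
  | const k =>
    intro t d hc ht hd hdM
    obtain ⟨x1, l1⟩ := exec_set (off := off) hd (.const (tmp S t) k) (tmp S t) k rfl
      (hS (Expr.const k) t ht (by simpa only [Expr.size, pow_one, Expr.ConstLT] using hc))
    refine ⟨_, x1, ?_, ?_, ?_, rfl, l1⟩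
    · simp [Config.set_mem, Expr.eval]
    · intro y
      simp [Config.set_mem, tmp]
    · intro t' ht'
      have := tmp_ne (V := V) S ht' (by simp only [Expr.size] at ht; omega)
      simp [Config.set_mem, this]
  | add a b iha ihb =>
    exact hbin a b _ .add (· + ·) (fun _ _ _ _ => rfl) (fun _ => rfl) (fun _ => rfl) rfl id iha ihb
  | sub a b iha ihb =>
    exact hbin a b _ .sub (· - ·) (fun _ _ _ _ => rfl) (fun _ => rfl) (fun _ => rfl) rfl id iha ihb
  | mul a b iha ihb =>
    exact hbin a b _ .mul (· * ·) (fun _ _ _ _ => rfl) (fun _ => rfl) (fun _ => rfl) rfl id iha ihb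
  | div a b iha ihb =>
    exact hbin a b _ .div (· / ·) (fun _ _ _ _ => rfl) (fun _ => rfl) (fun _ => rfl) rfl id iha ihb
  | query a iha =>
    intro t d hc ht hd hdM
    obtain ⟨d1, x1, v1, m1, t1, s1, l1⟩ := iha t d hc ht hd hdM
    obtain ⟨x3, l3⟩ := exec_set (off := off) l1 (.query (tmp S t) (tmp S t)) (tmp S t) _ rfl
      (hS (.query a) t ht (by rw [v1]; exact (Expr.query a).eval_lt hM hσ hdM hc))
    refine ⟨_, .seq _ _ _ _ _ x1 x3, ?_, ?_, ?_, s1, l3⟩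
    · rw [Config.set_mem, if_pos rfl, v1]
      rfl
    · intro x
      rw [Config.set_mem, if_neg (by simp [tmp]), m1]
    · intro t' ht'
      rw [Config.set_mem, if_neg (tmp_ne S ht' (by have := a.size_pos; simp only [Expr.size] at ht; omega)), t1 _ ht']

/-- A configuration of the register machine that agrees with a configuration of the
structured language, up to scratch registers. -/
structure Agree (c : Config V σ) (d : Config (V ⊕ Fin (S + 1)) σ) (B : ℕ) : Prop where
  mem : ∀ x, d.mem (.inl x) = c.mem x
  stream : d.stream = c.stream
  lt : d.LT B

/-- Named registers stay below `M` and scratch registers below `M ^ S = 2 ^ L`, so at every moment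
each register has at most `L` bits. -/
theorem Big.exec_compile {M : ℕ} (hM : 2 ≤ M) (hσ : σ < M) (hL : M ^ S = 2 ^ L) (hS : 1 ≤ S)
    {p : Cmd V} {c c' : Config V σ} (h : Big off M p c c') : p.Fits S M → c.LT M →
    ∀ d : Config (V ⊕ Fin (S + 1)) σ, Agree c d (2 ^ L) →
    ∃ d', Exec off (Fintype.card (V ⊕ Fin (S + 1)) * L) (p.compile S) d d' ∧
      Agree c' d' (2 ^ L) ∧ c'.LT M := by
  have hML : M ≤ 2 ^ L := hL ▸ Nat.le_self_pow (by omega) M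
  have hpos : 0 < 2 ^ L := by positivity
  have hexpr : ∀ (e : Expr V) (c : Config V σ) (d : Config (V ⊕ Fin (S + 1)) σ),
      e.size ≤ S ∧ e.ConstLT M → c.LT M → Agree c d (2 ^ L) →
      ∃ d', Exec off (Fintype.card (V ⊕ Fin (S + 1)) * L) (e.compile S 0) d d' ∧
        Agree c d' (2 ^ L) ∧ d'.mem (tmp S 0) = e.eval off c.mem := by
    intro e c d he hc hd
    obtain ⟨d1, x1, v1, m1, t1, s1, l1⟩ := e.exec_compile (off := off) hM hσ hL 0 d he.2
      (by omega) hd.lt (fun x => by rw [hd.mem]; exact hc x)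
    refine ⟨d1, x1, ⟨fun x => (m1 x).trans (hd.mem x), s1.trans hd.stream, l1⟩, ?_⟩
    rw [v1]
    congr 1
    exact funext hd.mem
  induction h with
  | skip c =>
    intro _ hc d hd
    obtain ⟨x1, l1⟩ := exec_set (off := off) hd.lt (.const (tmp S 0) 0) (tmp S 0) 0 rfl hpos
    refine ⟨_, x1, ⟨?_, hd.stream, l1⟩, hc⟩
    intro x
    simp [Config.set_mem, tmp, hd.mem]
  | assign x e c hv =>
    intro hf hc d hd
    obtain ⟨d1, x1, a1, v1⟩ := hexpr e c d hf hc hd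
    obtain ⟨x2, l2⟩ := exec_set (off := off) a1.lt (.const (.inl x) 0) (.inl x) 0 rfl hpos
    obtain ⟨x3, l3⟩ := exec_set (off := off) l2 (.add (.inl x) (.inl x) (tmp S 0)) (.inl x)
      (e.eval off c.mem) (by simp [Instr.step, Config.set_mem, tmp, ← v1]) (by omega)
    refine ⟨_, .seq _ _ _ _ _ x1 (.seq _ _ _ _ _ x2 x3), ⟨?_, a1.stream, l3⟩, hc.set x hv⟩
    intro y
    simp only [Config.set_mem, Sum.inl.injEq, a1.mem]
    split_ifs <;> rfl
  | read x c =>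
    intro hf hc d hd
    have hl : ((Instr.read (.inl x)).step off d).LT (2 ^ L) := by
      intro y
      simp only [Instr.step, Function.update_apply]
      split_ifs
      · exact (charCode_le _).trans_lt (by omega)
      · exact hd.lt y
    refine ⟨_, .instr _ _ hd.lt.bits_le hl.bits_le, ⟨?_, ?_, hl⟩, ?_⟩
    · intro y
      simp only [Instr.step, Function.update_apply, Sum.inl.injEq, hd.stream, hd.mem]
    · simp [Instr.step, hd.stream]
    · intro y
      simp only [Function.update_apply]
      split_ifs
      · exact (charCode_le _).trans_lt hσ
      · exact hc y
  | seq p q c c' c'' _ _ ih1 ih2 =>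
    intro hf hc d hd
    obtain ⟨d1, x1, a1, l1⟩ := ih1 hf.1 hc d hd
    obtain ⟨d2, x2, a2, l2⟩ := ih2 hf.2 l1 d1 a1
    exact ⟨d2, .seq _ _ _ _ _ x1 x2, a2, l2⟩
  | ite_true e p q c c' he _ ih =>
    intro hf hc d hd
    obtain ⟨d1, x1, a1, v1⟩ := hexpr e c d hf.1 hc hd
    obtain ⟨d2, x2, a2, l2⟩ := ih hf.2.1 hc d1 a1
    exact ⟨d2, .seq _ _ _ _ _ x1 (.ite_true _ _ _ _ _ (by rwa [v1]) x2), a2, l2⟩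
  | ite_false e p q c c' he _ ih =>
    intro hf hc d hd
    obtain ⟨d1, x1, a1, v1⟩ := hexpr e c d hf.1 hc hd
    obtain ⟨d2, x2, a2, l2⟩ := ih hf.2.2 hc d1 a1
    exact ⟨d2, .seq _ _ _ _ _ x1 (.ite_false _ _ _ _ _ (by rwa [v1]) x2), a2, l2⟩
  | while_true e p c c' c'' he _ _ ih1 ih2 =>
    intro hf hc d hd
    obtain ⟨d1, x1, a1, v1⟩ := hexpr e c d hf.1 hc hd
    obtain ⟨d2, x2, a2, l2⟩ := ih1 hf.2 hc d1 a1
    obtain ⟨d3, x3, a3, l3⟩ := ih2 hf l2 d2 a2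
    -- The induction hypothesis runs the test followed by the loop. The test belongs to the end of
    -- the compiled loop body, so the run is cut there and reassembled.
    cases x3 with
    | seq _ _ _ d4 _ y1 y2 =>
      exact ⟨d3, .seq _ _ _ _ _ x1 (.loop_true _ _ _ _ _ (by rwa [v1]) (.seq _ _ _ _ _ x2 y1) y2),
        a3, l3⟩
  | while_false e p c he =>
    intro hf hc d hd
    obtain ⟨d1, x1, a1, v1⟩ := hexpr e c d hf.1 hc hd
    exact ⟨d1, .seq _ _ _ _ _ x1 (.loop_false _ _ _ (by rwa [v1]) a1.lt.bits_le), a1, hc⟩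

end Compilation

/-! ### Weakest preconditions and frame conditions. -/

section WeakestPrecondition

variable {V : Type} {σ : ℕ}

/-- The registers that a command may change. -/
def Cmd.writes : Cmd V → List V
  | .skip => []
  | .assign x _ => [x]
  | .read x => [x]
  | .seq p q => p.writes ++ q.writes
  | .ite _ p q => p.writes ++ q.writes
  | .while _ p => p.writes

/-- Whether the command reads the online string. -/
def Cmd.reads : Cmd V → Bool
  | .skip => false
  | .assign _ _ => false
  | .read _ => true
  | .seq p q => p.reads || q.reads
  | .ite _ p q => p.reads || q.reads
  | .while _ p => p.reads

/-- Run a list of commands in order. -/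
def Cmd.block : List (Cmd V) → Cmd V
  | [] => .skip
  | [p] => p
  | p :: ps => .seq p (Cmd.block ps)

/-- What is not changed by a run of `p` from `c` to `c'`. -/
structure Frame (p : Cmd V) (c c' : Config V σ) : Prop where
  mem : ∀ x, x ∉ p.writes → c'.mem x = c.mem x
  stream : p.reads = false → c'.stream = c.stream

theorem frame_iff {p : Cmd V} {c c' : Config V σ} : Frame p c c' ↔
    (∀ x, x ∉ p.writes → c'.mem x = c.mem x) ∧ (p.reads = false → c'.stream = c.stream) :=
  ⟨fun h => ⟨h.mem, h.stream⟩, fun h => ⟨h.1, h.2⟩⟩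

theorem Frame.refl (p : Cmd V) (c : Config V σ) : Frame p c c := ⟨fun _ _ => rfl, fun _ => rfl⟩

theorem Frame.trans {p : Cmd V} {c c' c'' : Config V σ} (h : Frame p c c') (h' : Frame p c' c'') :
    Frame p c c'' :=
  ⟨fun x hx => (h'.mem x hx).trans (h.mem x hx), fun hr => (h'.stream hr).trans (h.stream hr)⟩

variable [DecidableEq V] {off : List (Fin σ)} {M : ℕ}

theorem Big.frame {p : Cmd V} {c c' : Config V σ} (h : Big off M p c c') : Frame p c c' := by
  induction h with
  | skip c => exact .refl _ _
  | assign x e c _ =>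
    refine ⟨fun y hy => ?_, fun _ => rfl⟩
    rw [Config.set_mem, if_neg (by simpa [Cmd.writes] using hy)]
  | read x c =>
    refine ⟨fun y hy => ?_, fun h => by simp [Cmd.reads] at h⟩
    exact Function.update_of_ne (by simpa [Cmd.writes] using hy) _ _
  | seq p q c c' c'' _ _ h1 h2 =>
    simp only [frame_iff, Cmd.writes, Cmd.reads, List.mem_append, Bool.or_eq_false_iff] at *
    grind
  | ite_true e p q c c' _ _ h1 =>
    simp only [frame_iff, Cmd.writes, Cmd.reads, List.mem_append, Bool.or_eq_false_iff] at *
    grind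
  | ite_false e p q c c' _ _ h1 =>
    simp only [frame_iff, Cmd.writes, Cmd.reads, List.mem_append, Bool.or_eq_false_iff] at *
    grind
  | while_true e p c c' c'' _ _ _ h1 h2 => exact Frame.trans ⟨h1.mem, h1.stream⟩ h2
  | while_false e p c _ => exact .refl _ _

theorem Big.lt (hσ : σ < M) {p : Cmd V} {c c' : Config V σ} (h : Big off M p c c') :
    c.LT M → c'.LT M := by
  induction h with
  | skip c => exact id
  | assign x e c hv => exact fun hc => hc.set x hv
  | read x c =>
    intro hc y
    simp only [Function.update_apply]
    split_ifs
    · exact (charCode_le _).trans_lt hσ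
    · exact hc y
  | seq p q c c' c'' _ _ h1 h2 => exact fun hc => h2 (h1 hc)
  | ite_true e p q c c' _ _ h1 => exact h1
  | ite_false e p q c c' _ _ h1 => exact h1
  | while_true e p c c' c'' _ _ _ h1 h2 => exact fun hc => h2 (h1 hc)
  | while_false e p c _ => exact id

/-- Weakest precondition: the command halts from `c` in a configuration that satisfies `Q`. -/
def WP (off : List (Fin σ)) (M : ℕ) (p : Cmd V) (Q : Config V σ → Prop) (c : Config V σ) : Prop :=
  ∃ c', Big off M p c c' ∧ Q c'

theorem wp_skip {Q : Config V σ → Prop} {c : Config V σ} : WP off M .skip Q c ↔ Q c :=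
  ⟨fun ⟨_, h, hq⟩ => by cases h; exact hq, fun h => ⟨c, .skip c, h⟩⟩

theorem wp_assign {Q : Config V σ → Prop} {c : Config V σ} {x : V} {e : Expr V} :
    WP off M (.assign x e) Q c ↔ e.eval off c.mem < M ∧ Q (c.set x (e.eval off c.mem)) :=
  ⟨fun ⟨_, h, hq⟩ => by cases h; exact ⟨by assumption, hq⟩, fun h => ⟨_, .assign x e c h.1, h.2⟩⟩

theorem wp_read {Q : Config V σ → Prop} {c : Config V σ} {x : V} :
    WP off M (.read x) Q c ↔
      Q ⟨Function.update c.mem x (charCode c.stream.head?), c.stream.tail⟩ :=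
  ⟨fun ⟨_, h, hq⟩ => by cases h; exact hq, fun h => ⟨_, .read x c, h⟩⟩

theorem wp_seq {Q : Config V σ → Prop} {c : Config V σ} {p q : Cmd V} :
    WP off M (.seq p q) Q c ↔ WP off M p (fun c' => WP off M q Q c') c :=
  ⟨fun ⟨_, h, hq⟩ => by cases h with | seq _ _ _ c' _ h1 h2 => exact ⟨c', h1, _, h2, hq⟩,
    fun ⟨_, h1, _, h2, hq⟩ => ⟨_, .seq _ _ _ _ _ h1 h2, hq⟩⟩

theorem wp_ite {Q : Config V σ → Prop} {c : Config V σ} {e : Expr V} {p q : Cmd V} :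
    WP off M (.ite e p q) Q c ↔
      (e.eval off c.mem ≠ 0 → WP off M p Q c) ∧ (e.eval off c.mem = 0 → WP off M q Q c) := by
  constructor
  · rintro ⟨_, h, hq⟩
    cases h with
    | ite_true _ _ _ _ _ he h => exact ⟨fun _ => ⟨_, h, hq⟩, fun h0 => absurd h0 he⟩
    | ite_false _ _ _ _ _ he h => exact ⟨fun h0 => absurd he h0, fun _ => ⟨_, h, hq⟩⟩
  · rintro ⟨h1, h2⟩
    by_cases he : e.eval off c.mem = 0
    · obtain ⟨_, h, hq⟩ := h2 he
      exact ⟨_, .ite_false _ _ _ _ _ he h, hq⟩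
    · obtain ⟨_, h, hq⟩ := h1 he
      exact ⟨_, .ite_true _ _ _ _ _ he h, hq⟩

/-- The consequence rule. It supplies the register bound and the frame condition, so specifications
need only mention what changes. -/
theorem WP.imp {p : Cmd V} {Q R : Config V σ → Prop} {c : Config V σ} (hσ : σ < M) (hc : c.LT M)
    (h : WP off M p R c) (k : ∀ c', c'.LT M → Frame p c c' → R c' → Q c') : WP off M p Q c :=
  let ⟨c', hb, hr⟩ := h
  ⟨c', hb, k c' (hb.lt hσ hc) hb.frame hr⟩

/-- Loop rule: `I m` is the invariant when the measure is `m`. -/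
theorem wp_while (hσ : σ < M) {e : Expr V} {p : Cmd V} {Q : Config V σ → Prop}
    {c₀ : Config V σ} (hc₀ : c₀.LT M) (I : ℕ → Config V σ → Prop) {m₀ : ℕ} (h₀ : I m₀ c₀)
    (hstep : ∀ m c, c.LT M → Frame p c₀ c → I m c → e.eval off c.mem ≠ 0 →
      WP off M p (fun c' => ∃ m' < m, I m' c') c)
    (hend : ∀ m c, c.LT M → Frame p c₀ c → I m c → e.eval off c.mem = 0 → Q c) :
    WP off M (.while e p) Q c₀ := by
  have key : ∀ m c, c.LT M → Frame p c₀ c → I m c → WP off M (.while e p) Q c := by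
    intro m
    induction m using Nat.strong_induction_on with
    | _ m ih =>
      intro c hc hf hI
      by_cases he : e.eval off c.mem = 0
      · exact ⟨c, .while_false _ _ _ he, hend m c hc hf hI he⟩
      · obtain ⟨c', hb, m', hm', hI'⟩ := hstep m c hc hf hI he
        obtain ⟨c'', hb', hq⟩ := ih m' hm' c' (hb.lt hσ hc) (hf.trans hb.frame) hI'
        exact ⟨c'', .while_true _ _ _ _ _ he hb hb', hq⟩
  exact key m₀ c₀ hc₀ (.refl _ _) h₀

end WeakestPrecondition

/-! ### The program. -/

/-- The registers of the algorithm. -/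
inductive Reg : Type
  | n | B | y | j | Q | P0 | t | q | x | K | E
  | fl | fr | fx | ff | fp | fi
  | cnt | ch | T | wc | wi | wl | wr
  | P | l | r | a | md | v | S | i | bs | u
  | l0 | r0 | bv | bl | br
  deriving DecidableEq

instance : Fintype Reg where
  elems := {.n, .B, .y, .j, .Q, .P0, .t, .q, .x, .K, .E, .fl, .fr, .fx, .ff, .fp, .fi,
    .cnt, .ch, .T, .wc, .wi, .wl, .wr, .P, .l, .r, .a, .md, .v, .S, .i, .bs, .u,
    .l0, .r0, .bv, .bl, .br}
  complete z := by cases z <;> decide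

namespace Reg

open Cmd

/-- `x mod y` -/
def modE (a b : Expr Reg) : Expr Reg := .sub a (.mul (.div a b) b)

/-- Look for a character with code `fx` in the offline string between `fl` and `fr`: `ff` tells
whether there is one, and then `fp` is its position. -/
def findChar : Cmd Reg := block [
  assign ff (.const 0),
  assign fi (.var fl),
  .while (.sub (.var fr) (.var fi)) (block [
    ite (.add (.sub (.query (.var fi)) (.var fx)) (.sub (.var fx) (.query (.var fi)))) skip
      (block [assign ff (.const 1), assign fp (.var fi)]),
    assign fi (.add (.var fi) (.const 1))])]

/-- Character number `a`, from the end, of the concatenation of the top `cnt` substrings on the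
stack `K`. -/
def charAt : Cmd Reg := block [
  assign T (.var K),
  assign wc (.var cnt),
  assign wi (.var a),
  assign ch (.const 0),
  .while (.var wc) (block [
    assign wr (modE (.var T) (.var Q)),
    assign T (.div (.var T) (.var Q)),
    assign wl (modE (.var T) (.var Q)),
    assign T (.div (.var T) (.var Q)),
    ite (.sub (.sub (.var wr) (.var wl)) (.var wi))
      (block [
        assign ch (.query (.sub (.sub (.var wr) (.const 1)) (.var wi))),
        assign wc (.const 0)])
      (block [
        assign wi (.sub (.var wi) (.sub (.var wr) (.var wl))),
        assign wc (.sub (.var wc) (.const 1))])])]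

/-- The edit distance of a substring of the offline string and a string of at most one
character. -/
def leafCost : Cmd Reg := block [
  charAt,
  ite (.var ch)
    (block [
      assign fl (.var l),
      assign fr (.var r),
      assign fx (.var ch),
      findChar,
      assign v (.sub (.add (.sub (.var r) (.var l)) (.sub (.const 1) (.sub (.var r) (.var l))))
        (.var ff))])
    (assign v (.sub (.var r) (.var l))),
  assign md (.const 1)]

/-- Push a register to the stack `S`. -/
def pushReg (z : Reg) : Cmd Reg := assign S (.add (.mul (.var S) (.var Q)) (.var z))

/-- Pop a register from the stack `S`. -/
def popReg (z : Reg) : Cmd Reg := block [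
  assign z (modE (.var S) (.var Q)),
  assign S (.div (.var S) (.var Q))]

/-- Save the frame of the current call and start the next recursive call. -/
def dispatch : Cmd Reg := block [
  pushReg P, pushReg l, pushReg r, pushReg a, pushReg i, pushReg bs, pushReg u,
  assign P (.div (.var P) (.const 2)),
  ite (modE (.var i) (.const 2))
    (block [
      assign r (.add (.var l) (.div (.var i) (.const 2))),
      assign a (.add (.var a) (.var P))])
    (assign l (.add (.var l) (.div (.var i) (.const 2)))),
  assign md (.const 0)]

/-- Process the value returned by a recursive call. -/
def resume : Cmd Reg := block [
  popReg u, popReg bs, popReg i, popReg a, popReg r, popReg l, popReg P,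
  ite (modE (.var i) (.const 2))
    (ite (.sub (.var bs) (.add (.var u) (.var v))) (assign bs (.add (.var u) (.var v))) skip)
    (assign u (.var v)),
  assign i (.add (.var i) (.const 1)),
  ite (.sub (.add (.mul (.const 2) (.sub (.var r) (.var l))) (.const 2)) (.var i))
    dispatch
    (assign v (.var bs))]

/-- Start a call. -/
def enter : Cmd Reg :=
  ite (.sub (.var P) (.const 1))
    (block [
      assign i (.const 0),
      assign bs (.sub (.var Q) (.const 1)),
      assign u (.const 0),
      dispatch])
    leafCost

/-- One step of the recursive evaluation of an edit distance. -/
def evalStep : Cmd Reg := ite (.var md) resume enter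

/-- There is something left to evaluate. -/
def evalCond : Expr Reg := .add (.sub (.const 1) (.var md)) (.var S)

/-- The edit distance of the substring of the offline string between `l` and `r` and the
concatenation of the top `cnt` substrings on the stack `K`. -/
def evalDist : Cmd Reg := block [
  assign P (.var P0),
  assign a (.const 0),
  assign md (.const 0),
  assign S (.const 0),
  .while evalCond evalStep]

/-- Find the substring of the offline string that is nearest to the concatenation of the top
`cnt` substrings on the stack. -/
def nearest : Cmd Reg := block [
  assign bv (.sub (.var Q) (.const 1)),
  assign l0 (.const 0),
  .while (.sub (.add (.var n) (.const 1)) (.var l0)) (block [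
    assign r0 (.var l0),
    .while (.sub (.add (.var n) (.const 1)) (.var r0)) (block [
      assign l (.var l0),
      assign r (.var r0),
      evalDist,
      ite (.sub (.var bv) (.var v))
        (block [assign bv (.var v), assign bl (.var l0), assign br (.var r0)]) skip,
      assign r0 (.add (.var r0) (.const 1))]),
    assign l0 (.add (.var l0) (.const 1))])]

/-- Push the substring between `bl` and `br` to the stack. -/
def pushBest : Cmd Reg :=
  assign K (.add (.mul (.add (.mul (.var K) (.var Q)) (.var bl)) (.var Q)) (.var br))

/-- Replace the top `B` substrings on the stack by the one nearest to their concatenation. -/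
def mergeTop : Cmd Reg := block [
  nearest,
  assign E (.add (.var E) (.var bv)),
  assign j (.var B),
  .while (.var j) (block [
    assign K (.div (.div (.var K) (.var Q)) (.var Q)),
    assign j (.sub (.var j) (.const 1))]),
  pushBest]

/-- Read a character and push the substring nearest to it. -/
def readLeaf : Cmd Reg := block [
  read x,
  assign fl (.const 0),
  assign fr (.var n),
  assign fx (.var x),
  findChar,
  ite (.var ff)
    (block [assign bl (.var fp), assign br (.add (.var fp) (.const 1))])
    (block [assign bl (.const 0), assign br (.const 0), assign E (.add (.var E) (.const 1))]),
  pushBest]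

/-- Find the least `B ≥ 2` with `n ≤ B ^ k`. -/
def chooseBase (k : ℕ) : Cmd Reg := block [
  assign B (.const 1),
  assign y (.const 1),
  .while (.var y) (block [
    assign B (.add (.var B) (.const 1)),
    assign y (.sub (.var n) (.const 1)),
    assign j (.const k),
    .while (.var j) (block [
      assign y (.div (.var y) (.var B)),
      assign j (.sub (.var j) (.const 1))])])]

/-- Find the base of the packings, and a power of two that is at least `n ^ 2`. -/
def setup : Cmd Reg := block [
  assign Q (.mul (.const 4) (.mul (.add (.var n) (.const 2)) (.add (.var n) (.const 2)))),
  assign P0 (.const 1),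
  .while (.sub (.mul (.var n) (.var n)) (.var P0)) (assign P0 (.mul (.const 2) (.var P0)))]

/-- One round: a character is read, and full levels of the stack are merged. -/
def round : Cmd Reg := block [
  readLeaf,
  assign t (.add (.var t) (.const 1)),
  assign q (.var t),
  .while (.sub (.const 1) (modE (.var q) (.var B))) (block [
    mergeTop,
    assign q (.div (.var q) (.var B))])]

/-- The whole algorithm with `k` levels. -/
def main (k : ℕ) : Cmd Reg := block [
  chooseBase k,
  setup,
  assign cnt (.var B),
  assign t (.const 0),
  .while (.sub (.var n) (.var t)) round,
  assign cnt (.var n),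
  assign l (.const 0),
  assign r (.var n),
  evalDist,
  assign E (.add (.var E) (.var v))]

end Reg

/-! ### Packed stacks and access to single characters. -/

/-- The number that encodes a stack of pairs, the top first. -/
def stackCode (Q : ℕ) : List (ℕ × ℕ) → ℕ
  | [] => 0
  | p :: ps => (stackCode Q ps * Q + p.1) * Q + p.2

/-- The concatenation of the substrings on a stack, reversed; the top of the stack, which is the
last substring, comes first. -/
def pieces {α : Type} (s : List α) (ps : List (ℕ × ℕ)) : List α :=
  ps.flatMap fun p => (sub s p.1 p.2).reverse

theorem mul_add_div_base {Q x : ℕ} (h : x < Q) (K : ℕ) : (K * Q + x) / Q = K := by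
  rw [mul_comm, Nat.mul_add_div (by omega), Nat.div_eq_of_lt h, add_zero]

theorem sub_div_mul (x y : ℕ) : x - x / y * y = x % y := by
  have := Nat.div_add_mod' x y
  omega

theorem mul_add_mod_base {Q x : ℕ} (h : x < Q) (K : ℕ) : (K * Q + x) % Q = x := by
  rw [mul_comm, Nat.mul_add_mod, Nat.mod_eq_of_lt h]

theorem reverse_sub_getElem? {α : Type} (s : List α) {l r i : ℕ} (hr : r ≤ s.length)
    (hi : i < r - l) : (sub s l r).reverse[i]? = s[r - 1 - i]? := by
  rw [List.getElem?_reverse (by rw [length_sub s l r hr]; exact hi), length_sub s l r hr]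
  simp only [sub, List.getElem?_drop, List.getElem?_take]
  rw [if_pos (by omega)]
  congr 1
  omega

namespace Reg

variable {σ : ℕ} {off : List (Fin σ)} {M : ℕ} {c : Config Reg σ}

theorem eval_modE (x y : Expr Reg) (m : Reg → ℕ) :
    (modE x y).eval off m = x.eval off m % y.eval off m := sub_div_mul _ _

theorem wp_findChar (hσ : σ < M) (hM : 2 ≤ M) (hc : c.LT M) :
    WP off M findChar (fun c' => c'.mem ff ≤ 1 ∧
      (c'.mem ff = 1 → c.mem fl ≤ c'.mem fp ∧ c'.mem fp < c.mem fr ∧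
        charCode off[c'.mem fp]? = c.mem fx) ∧
      (c'.mem ff = 0 → ∀ i, c.mem fl ≤ i → i < c.mem fr → charCode off[i]? ≠ c.mem fx)) c := by
  simp only [findChar, Cmd.block, wp_seq, wp_assign, Expr.eval, Config.set_mem, reduceCtorEq,
    if_false]
  refine ⟨by omega, hc _, ?_⟩
  refine wp_while hσ ((hc.set _ (by omega)).set _ (hc _))
    (fun m c' => m = c.mem fr - c'.mem fi ∧ c.mem fl ≤ c'.mem fi ∧ c'.mem ff ≤ 1 ∧
      (c'.mem ff = 1 → c.mem fl ≤ c'.mem fp ∧ c'.mem fp < c.mem fr ∧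
        charCode off[c'.mem fp]? = c.mem fx) ∧
      (c'.mem ff = 0 → ∀ i, c.mem fl ≤ i → i < c'.mem fi → charCode off[i]? ≠ c.mem fx))
    ⟨rfl, ?_⟩ ?_ ?_
  · simp [Config.set_mem]
    grind
  · rintro m c' hc' hf ⟨hm, h1, h2, h3, h4⟩ he
    have e1 : c'.mem fr = c.mem fr := by simp [hf.mem fr (by decide), Config.set_mem]
    have e2 : c'.mem fx = c.mem fx := by simp [hf.mem fx (by decide), Config.set_mem]
    simp only [Expr.eval, e1] at he
    have := hc fr
    simp only [wp_seq, wp_assign, wp_ite, wp_skip, Expr.eval, Config.set_mem, reduceCtorEq,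
      if_false, if_true, e2]
    refine ⟨fun h => ⟨by omega, _, ?_, rfl, ?_⟩, fun h => ⟨by omega, hc' _, by omega, _, ?_, rfl, ?_⟩⟩
    · omega
    · grind
    · omega
    · grind
  · rintro m c' hc' hf ⟨hm, h1, h2, h3, h4⟩ he
    have e1 : c'.mem fr = c.mem fr := by simp [hf.mem fr (by decide), Config.set_mem]
    simp only [Expr.eval, e1] at he
    exact ⟨h2, h3, fun h i hi hi' => h4 h i hi (by omega)⟩

/-- The entries of the stack `ps` are substrings of the offline string. -/
def Valid (n : ℕ) (ps : List (ℕ × ℕ)) : Prop := ∀ p ∈ ps, p.1 ≤ p.2 ∧ p.2 ≤ n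

/-- The concatenation is never stored: the substrings are walked through from the top, subtracting
their lengths from the index until it falls inside one of them. -/
theorem wp_charAt (hσ : σ < M) (hM : 2 ≤ M) (hc : c.LT M) {ps : List (ℕ × ℕ)}
    (hQ : off.length < c.mem Q) (hK : c.mem K = stackCode (c.mem Q) ps)
    (hps : Valid off.length ps) :
    WP off M charAt (fun c' =>
      c'.mem ch = charCode (pieces off (ps.take (c.mem cnt)))[c.mem a]?) c := by
  simp only [charAt, Cmd.block, wp_seq, wp_assign, Expr.eval, Config.set_mem, reduceCtorEq,
    if_false]
  refine ⟨hc _, hc _, hc _, by omega, ?_⟩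
  refine wp_while hσ ((((hc.set _ (hc _)).set _ (hc _)).set _ (hc _)).set _ (by omega))
    -- Either the character has been found, which is signalled by `wc = 0`, or it is character `wi`
    -- of the top `wc` substrings of the remaining stack `ps'`.
    (fun m c' => m = c'.mem wc ∧
      (c'.mem wc = 0 ∧ c'.mem ch = charCode (pieces off (ps.take (c.mem cnt)))[c.mem a]? ∨
        c'.mem ch = 0 ∧ ∃ ps', Valid off.length ps' ∧ c'.mem T = stackCode (c.mem Q) ps' ∧
          (pieces off (ps.take (c.mem cnt)))[c.mem a]? =
            (pieces off (ps'.take (c'.mem wc)))[c'.mem wi]?))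
    ⟨rfl, ?_⟩ ?_ ?_
  · right
    simp only [Config.set_mem, reduceCtorEq, if_false, if_true]
    exact ⟨trivial, ps, hps, hK, rfl⟩
  · rintro m c' hc' hf ⟨hm, h⟩ he
    have e1 : c'.mem Q = c.mem Q := by simp [hf.mem Q (by decide), Config.set_mem]
    simp only [Expr.eval] at he
    rcases h with ⟨h0, _⟩ | ⟨h0, ps', hv, hT, hU⟩
    · exact absurd h0 he
    have hT1 := hc' T
    have hmod : ∀ x y, x < M → x % y < M := fun x y h => (Nat.mod_le _ _).trans_lt h
    have hdiv : ∀ x y, x < M → x / y < M := fun x y h => (Nat.div_le_self _ _).trans_lt h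
    have hwi := hc' wi
    have hwc := hc' wc
    obtain ⟨k, hk⟩ := Nat.exists_eq_succ_of_ne_zero he
    simp only [wp_seq, wp_assign, wp_ite, Expr.eval, eval_modE, Config.set_mem, reduceCtorEq,
      if_false, if_true, e1]
    refine ⟨hmod _ _ hT1, hdiv _ _ hT1, hmod _ _ (hdiv _ _ hT1), hdiv _ _ (hdiv _ _ hT1),
      fun h => ⟨(charCode_le _).trans_lt hσ, by omega, 0, by omega, rfl, .inl ⟨trivial, ?_⟩⟩,
      fun h => ⟨by omega, by omega, _, ?_, rfl, .inr ⟨h0, ?_⟩⟩⟩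
    · rw [hU, hk]
      cases ps' with
      | nil => simp [hT, stackCode] at h
      | cons p ps' =>
        have hp := hv p (by simp)
        rw [hT, stackCode, mul_add_mod_base (by omega), mul_add_div_base (by omega),
          mul_add_mod_base (by omega)] at h
        rw [hT, stackCode, mul_add_mod_base (by omega), List.take_succ_cons, pieces,
          List.flatMap_cons, List.getElem?_append_left, reverse_sub_getElem? _ hp.2 (by omega)]
        rw [List.length_reverse, length_sub _ _ _ hp.2]
        omega
    · omega
    · rw [hU, hk]
      cases ps' with
      -- A count larger than the stack is harmless: the code 0 yields empty substrings. The final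
      -- evaluation may use such a count.
      | nil => exact ⟨[], hv, by simp [hT, stackCode], by simp [pieces]⟩
      | cons p ps' =>
        have hp := hv p (by simp)
        rw [hT, stackCode, mul_add_mod_base (by omega), mul_add_div_base (by omega),
          mul_add_mod_base (by omega)] at h
        refine ⟨ps', fun p hp => hv p (by simp [hp]), ?_, ?_⟩
        · rw [hT, stackCode, mul_add_div_base (by omega), mul_add_div_base (by omega)]
        · rw [hT, stackCode, mul_add_mod_base (by omega), mul_add_div_base (by omega),
            mul_add_mod_base (by omega), List.take_succ_cons, pieces,
            List.flatMap_cons, List.getElem?_append_right, List.length_reverse,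
            length_sub _ _ _ hp.2]
          · simp [pieces]
          · rw [List.length_reverse, length_sub _ _ _ hp.2]
            omega
  · rintro m c' hc' hf ⟨hm, h⟩ he
    simp only [Expr.eval] at he
    rcases h with h | ⟨h0, ps', hv, hT, hU⟩
    · exact h.2
    · rw [h0, hU, he]
      simp [pieces, charCode]

end Reg

/-! ### Recursive evaluation of an edit distance in small space. -/

/-- The `P` characters of the reverse of `U` from position `a` on, counted from the end. -/
def seg {α : Type} (U : List α) (a P : ℕ) : List α := ((U.drop a).take P).reverse

/-- `U` is a reversed string, so the larger offset `a + P` belongs to the left part. -/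
theorem seg_add {α : Type} (U : List α) (a P P' : ℕ) :
    seg U a (P + P') = seg U (a + P) P' ++ seg U a P := by
  rw [seg, seg, seg, ← List.reverse_append, List.take_add, List.drop_drop]

theorem seg_one {α : Type} (U : List α) (a : ℕ) : seg U a 1 = U[a]?.toList := by
  rw [seg, List.take_one]
  cases h : U[a]? <;> simp [h]

theorem charCode_eq_iff {σ : ℕ} {o : Option (Fin σ)} {a : Fin σ} :
    charCode o = charCode (some a) ↔ o = some a := by
  cases o with
  | none => simp [charCode]
  | some b => simp [charCode, Fin.ext_iff]

namespace Reg

variable {σ : ℕ} {off : List (Fin σ)} {M : ℕ} {c : Config Reg σ}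

theorem wp_leafCost (hσ : σ < M) (hM : 2 ≤ M) (hc : c.LT M) {ps : List (ℕ × ℕ)}
    (hQ : off.length < c.mem Q) (hK : c.mem K = stackCode (c.mem Q) ps)
    (hps : Valid off.length ps) (hlr : c.mem l ≤ c.mem r) (hr : c.mem r ≤ off.length) :
    WP off M leafCost (fun c' => c'.mem md = 1 ∧ c'.mem v =
      ed (sub off (c.mem l) (c.mem r)) (seg (pieces off (ps.take (c.mem cnt))) (c.mem a) 1)) c := by
  simp only [leafCost, Cmd.block, wp_seq, wp_assign, wp_ite, Expr.eval]
  refine (wp_charAt hσ hM hc hQ hK hps).imp hσ hc fun c1 hc1 hf1 h1 => ?_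
  have el : c1.mem l = c.mem l := hf1.mem l (by decide)
  have er : c1.mem r = c.mem r := hf1.mem r (by decide)
  rw [el, er, h1, seg_one]
  have hlen := length_sub off (c.mem l) _ hr
  have hrM := hc r
  -- An offset beyond the string gives an empty segment, whose distance is the length of the
  -- substring. This is what allows padding to a power of two.
  cases hU : (pieces off (ps.take (c.mem cnt)))[c.mem a]? with
  | none => simp [Config.set_mem, charCode, ed_nil, hlen]; omega
  | some b =>
    refine ⟨fun _ => ?_, fun h => absurd h (by simp [charCode])⟩
    have hb : charCode (some b) < M := (charCode_le _).trans_lt hσ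
    simp only [Config.set_mem, reduceCtorEq, if_false]
    rw [er, h1, hU]
    refine ⟨by omega, by omega, hb, ?_⟩
    have hc2 := ((hc1.set fl (v := c.mem l) (by omega)).set fr (v := c.mem r) hrM).set fx hb
    refine (wp_findChar hσ hM hc2).imp hσ hc2 fun c3 hc3 hf3 ⟨h3, h4, h5⟩ => ?_
    have el' : c3.mem l = c.mem l := by
      rw [hf3.mem l (by decide)]; simp [Config.set_mem, el]
    have er' : c3.mem r = c.mem r := by
      rw [hf3.mem r (by decide)]; simp [Config.set_mem, er]
    simp only [Config.set_mem, reduceCtorEq, if_false, if_true, charCode_eq_iff, ne_eq] at h4 h5 ⊢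
    rw [el', er']
    refine ⟨by omega, by omega, trivial, ?_⟩
    rcases Nat.le_one_iff_eq_zero_or_eq_one.1 h3 with h0 | h0
    · rw [Option.toList_some, ed_singleton_of_not_mem, hlen, h0]
      · omega
      · rw [mem_sub]
        rintro ⟨i, hi, hi', hi2⟩
        exact h5 h0 i hi hi' hi2
    · rw [Option.toList_some, ed_singleton_of_mem, hlen, h0]
      · have := h4 h0
        omega
      · obtain ⟨h6, h7, h8⟩ := h4 h0
        exact (mem_sub off).2 ⟨_, h6, h7, h8⟩

/-- A saved call. -/
structure Call where
  P : ℕ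
  l : ℕ
  r : ℕ
  a : ℕ
  i : ℕ
  bs : ℕ
  u : ℕ

/-- The stack of calls after `f` has been pushed. -/
def Call.push (Q S : ℕ) (f : Call) : ℕ :=
  ((((((S * Q + f.P) * Q + f.l) * Q + f.r) * Q + f.a) * Q + f.i) * Q + f.bs) * Q + f.u

/-- The entries of the saved call are digits. -/
structure Call.LT (f : Call) (Q : ℕ) : Prop where
  P : f.P < Q
  l : f.l < Q
  r : f.r < Q
  a : f.a < Q
  i : f.i < Q
  bs : f.bs < Q
  u : f.u < Q

theorem mul_add_lt_pow {Q x S e : ℕ} (hx : x < Q) (hS : S < Q ^ e) : S * Q + x < Q ^ (e + 1) := by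
  rw [pow_succ]
  have := Nat.mul_le_mul_right Q (Nat.succ_le_of_lt hS)
  rw [Nat.succ_mul] at this
  omega

theorem Call.push_lt {f : Call} {Q S e : ℕ} (h : f.LT Q) (hS : S < Q ^ e) :
    f.push Q S < Q ^ (e + 7) :=
  mul_add_lt_pow h.u (mul_add_lt_pow h.bs (mul_add_lt_pow h.i (mul_add_lt_pow h.a
    (mul_add_lt_pow h.r (mul_add_lt_pow h.l (mul_add_lt_pow h.P hS))))))

/-- The state of the evaluation holds the call `f`. -/
structure Holds (c : Config Reg σ) (f : Call) (S : ℕ) : Prop where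
  P : c.mem .P = f.P
  l : c.mem .l = f.l
  r : c.mem .r = f.r
  a : c.mem .a = f.a
  i : c.mem .i = f.i
  bs : c.mem .bs = f.bs
  u : c.mem .u = f.u
  S : c.mem .S = S

/-- The first or second recursive call of `f` has been started. -/
structure Dispatched (c : Config Reg σ) (Q S : ℕ) (f : Call) : Prop where
  md : c.mem .md = 0
  S : c.mem .S = f.push Q S
  P : c.mem .P = f.P / 2
  first : f.i % 2 = 0 → c.mem .l = f.l + f.i / 2 ∧ c.mem .r = f.r ∧ c.mem .a = f.a
  second : f.i % 2 ≠ 0 → c.mem .l = f.l ∧ c.mem .r = f.l + f.i / 2 ∧ c.mem .a = f.a + f.P / 2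

/-- The exponent `e` bounds the number of base-`Q` digits already on the call stack; a saved frame
adds seven. The counter `f.i` encodes both the cut `f.l + f.i / 2` and, by its parity, which half is
evaluated; the right half comes first. -/
theorem wp_dispatch {f : Call} {S₀ e : ℕ} (hc : c.LT M) (hM : 2 ≤ M) (hf : f.LT (c.mem Q))
    (hS : S₀ < c.mem Q ^ e) (he : c.mem Q ^ (e + 7) ≤ M) (hh : Holds c f S₀)
    (h1 : f.l + f.i / 2 < M) (h2 : f.a + f.P / 2 < M) :
    WP off M dispatch (fun c' => Dispatched c' (c.mem Q) S₀ f) c := by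
  have hQ : 1 ≤ c.mem Q := by have := hf.P; omega
  have b1 := mul_add_lt_pow hf.P hS
  have b2 := mul_add_lt_pow hf.l b1
  have b3 := mul_add_lt_pow hf.r b2
  have b4 := mul_add_lt_pow hf.a b3
  have b5 := mul_add_lt_pow hf.i b4
  have b6 := mul_add_lt_pow hf.bs b5
  have b7 := mul_add_lt_pow hf.u b6
  have up : ∀ m, m ≤ e + 7 → c.mem Q ^ m ≤ M := fun m hm =>
    (Nat.pow_le_pow_right hQ hm).trans he
  have hP : f.P / 2 < M := by have := hc P; rw [hh.P] at this; omega
  simp only [dispatch, pushReg, Cmd.block, wp_seq, wp_assign, wp_ite, Expr.eval, eval_modE,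
    Config.set_mem, reduceCtorEq, if_false, if_true, hh.P, hh.l, hh.r, hh.a, hh.i,
    hh.bs, hh.u, hh.S]
  refine ⟨b1.trans_le (up _ (by omega)), b2.trans_le (up _ (by omega)),
    b3.trans_le (up _ (by omega)), b4.trans_le (up _ (by omega)), b5.trans_le (up _ (by omega)),
    b6.trans_le (up _ (by omega)), b7.trans_le (up _ (by omega)), hP,
    fun hi => ⟨h1, h2, by omega, ⟨?_, ?_, ?_, ?_, ?_⟩⟩, fun hi => ⟨h1, by omega, ⟨?_, ?_, ?_, ?_, ?_⟩⟩⟩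
  all_goals simp [hi, Config.set_mem, Call.push, hh.l, hh.r, hh.a]

/-- The call `f` after its current recursive call has returned `v`. -/
def Call.next (f : Call) (v : ℕ) : Call :=
  if f.i % 2 = 0 then { f with i := f.i + 1, u := v }
  else { f with i := f.i + 1, bs := min f.bs (f.u + v) }

theorem wp_resume {f : Call} {S₀ e : ℕ} (hσ : σ < M) (hc : c.LT M) (hM : 2 ≤ M)
    (hf : f.LT (c.mem Q)) (hf' : (f.next (c.mem v)).LT (c.mem Q))
    (hS₀ : S₀ < c.mem Q ^ e) (he : c.mem Q ^ (e + 7) ≤ M) (hS : c.mem S = f.push (c.mem Q) S₀)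
    (h1 : f.l + (f.i + 1) / 2 < M) (h2 : f.a + f.P / 2 < M) :
    WP off M resume (fun c' =>
      ((f.next (c.mem v)).i < 2 * (f.r - f.l) + 2 →
        Dispatched c' (c.mem Q) S₀ (f.next (c.mem v))) ∧
      (2 * (f.r - f.l) + 2 ≤ (f.next (c.mem v)).i →
        c'.mem v = (f.next (c.mem v)).bs ∧ c'.mem S = S₀ ∧ c'.mem md = c.mem md)) c := by
  have hQM : c.mem Q ≤ M := (Nat.le_self_pow (by omega) _).trans he
  have hSM : S₀ < M := hS₀.trans_le
    ((Nat.pow_le_pow_right (by have := hf.P; omega) (by omega)).trans he)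
  have hpush := (Call.push_lt hf hS₀).trans_le he
  have hdiv : ∀ {x} y, x * c.mem Q + y < M → x < M := fun {x} y h => by
    have := Nat.le_mul_of_pos_right x (show 0 < c.mem Q by have := hf.P; omega)
    omega
  unfold Call.push at hpush
  have b6 := hdiv _ hpush
  have b5 := hdiv _ b6
  have b4 := hdiv _ b5
  have b3 := hdiv _ b4
  have b2 := hdiv _ b3
  have b1 := hdiv _ b2
  simp only [resume, popReg, Cmd.block, wp_seq, wp_assign, Expr.eval, eval_modE,
    Config.set_mem, reduceCtorEq, if_false, if_true, hS, Call.push,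
    mul_add_mod_base hf.u, mul_add_div_base hf.u, mul_add_mod_base hf.bs, mul_add_div_base hf.bs,
    mul_add_mod_base hf.i, mul_add_div_base hf.i, mul_add_mod_base hf.a, mul_add_div_base hf.a,
    mul_add_mod_base hf.r, mul_add_div_base hf.r, mul_add_mod_base hf.l, mul_add_div_base hf.l,
    mul_add_mod_base hf.P, mul_add_div_base hf.P]
  have hfu := hf.u.trans_le hQM
  have hfbs := hf.bs.trans_le hQM
  have hfi := hf.i.trans_le hQM
  have hfa := hf.a.trans_le hQM
  have hfr := hf.r.trans_le hQM
  have hfl := hf.l.trans_le hQM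
  have hfP := hf.P.trans_le hQM
  refine ⟨hfu, b6, hfbs, b5, hfi, b4, hfa, b3, hfr, b2, hfl, b1, hfP, hSM, ?_⟩
  have hc1 := ((((((((((((((hc.set u hfu).set S b6).set bs hfbs).set S b5).set i hfi).set S b4).set
    a hfa).set S b3).set r hfr).set S b2).set l hfl).set S b1).set P hfP).set S hSM)
  generalize hg : f.next (c.mem v) = g at *
  have hgi : g.i = f.i + 1 := by rw [← hg]; unfold Call.next; split_ifs <;> rfl
  have hgl : g.l = f.l := by rw [← hg]; unfold Call.next; split_ifs <;> rfl
  have hgr : g.r = f.r := by rw [← hg]; unfold Call.next; split_ifs <;> rfl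
  have hga : g.a = f.a := by rw [← hg]; unfold Call.next; split_ifs <;> rfl
  have hgP : g.P = f.P := by rw [← hg]; unfold Call.next; split_ifs <;> rfl
  -- Intermediate state: the returned value has been processed, but the counter is not yet advanced.
  refine WP.imp (R := fun c' => Holds c' { g with i := f.i } S₀) hσ hc1 ?_ ?_
  · have hgu := hf'.u
    have hgb := hf'.bs
    simp only [wp_ite, wp_assign, wp_skip, Expr.eval, Config.set_mem, reduceCtorEq, if_false,
      if_true, eval_modE]
    rw [← hg]
    unfold Call.next
    refine ⟨fun h => ⟨fun h3 => ?_, fun h3 => ?_⟩, fun h => ?_⟩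
    · rw [← hg, Call.next, if_neg h] at hgb
      simp only at hgb
      have : min f.bs (f.u + c.mem v) = f.u + c.mem v := by omega
      refine ⟨by omega, ?_⟩
      constructor <;> simp [Config.set_mem, h, this]
    · have : min f.bs (f.u + c.mem v) = f.bs := by omega
      constructor <;> simp [Config.set_mem, h, this]
    · refine ⟨hc _, ?_⟩
      constructor <;> simp [Config.set_mem, h]
  · intro c' hc' hfr' hh
    have eQ : c'.mem Q = c.mem Q := by
      rw [hfr'.mem Q (by decide)]; simp [Config.set_mem]
    have emd : c'.mem md = c.mem md := by
      rw [hfr'.mem md (by decide)]; simp [Config.set_mem]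
    have hib := hf'.i
    rw [hgi] at hib
    simp only [wp_ite, wp_assign, Expr.eval, Config.set_mem, reduceCtorEq, if_false,
      if_true, hh.r, hh.l, hh.i, hh.bs, hh.S, hgr, hgl, hgi, emd]
    have hib' : f.i + 1 < M := by omega
    refine ⟨hib', fun h => ?_, fun h => ⟨by have := hf'.bs; omega, by omega, by simp⟩⟩
    have hc2 := hc'.set i hib'
    have hQ2 : (c'.set i (f.i + 1)).mem Q = c.mem Q := by simp [Config.set_mem, eQ]
    refine (wp_dispatch (off := off) (f := g) (S₀ := S₀) (e := e) hc2 hM (by rwa [hQ2])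
      (by rwa [hQ2]) (by rwa [hQ2]) ?_ (by rwa [hgl, hgi]) (by rwa [hga, hgP])).imp hσ hc2 ?_
    · constructor <;> simp [Config.set_mem, hh.P, hh.l, hh.r, hh.a, hh.bs, hh.u, hh.S, hgi]
    · intro c3 _ _ h3
      rw [hQ2] at h3
      exact ⟨fun _ => h3, fun _ => by omega⟩

end Reg

theorem ed_sub_add_le {α : Type} (s : List α) {l m r : ℕ} (h1 : l ≤ m) (h2 : m ≤ r)
    (t t' : List α) : ed (sub s l r) (t ++ t') ≤ ed (sub s l m) t + ed (sub s m r) t' := by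
  rw [← sub_append s h1 h2]
  exact ed_append_le _ _ _ _

theorem length_seg_le {α : Type} (U : List α) (a P : ℕ) : (seg U a P).length ≤ P := by
  simp [seg]

/-- The minimum of `bs` and of the costs between `lo` and `hi` is at most `best`. -/
def AttainedBy (cost : ℕ → ℕ) (lo hi bs best : ℕ) : Prop :=
  bs ≤ best ∨ ∃ m, lo ≤ m ∧ m ≤ hi ∧ cost m ≤ best

theorem AttainedBy.last {cost : ℕ → ℕ} {hi bs best : ℕ} (h : AttainedBy cost hi hi bs best) :
    min bs (cost hi) ≤ best := by
  rcases h with h | ⟨m, h1, h2, h3⟩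
  · omega
  · obtain rfl : m = hi := by omega
    omega

theorem AttainedBy.next {cost : ℕ → ℕ} {lo hi bs best : ℕ} (h : AttainedBy cost lo hi bs best) :
    AttainedBy cost (lo + 1) hi (min bs (cost lo)) best := by
  rcases h with h | ⟨m, h1, h2, h3⟩
  · exact .inl (by omega)
  · rcases h1.eq_or_lt with rfl | h1
    · exact .inl (by omega)
    · exact .inr ⟨m, h1, h2, h3⟩

namespace Reg

theorem Call.push_pos {f : Call} {Q S : ℕ} (hP : 0 < f.P) (hQ : 0 < Q) : 0 < f.push Q S := by
  unfold Call.push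
  have : ∀ x y, 0 < x → 0 < x * Q + y := fun x y hx => by positivity
  exact this _ _ (this _ _ (this _ _ (this _ _ (this _ _ (this _ _ (by omega))))))

variable {σ : ℕ} {off : List (Fin σ)} {M Q₀ k : ℕ} {ps : List (ℕ × ℕ)} {c c' : Config Reg σ}

/-- The registers that an evaluation uses and does not change. -/
structure Env (M Q₀ k : ℕ) (ps : List (ℕ × ℕ)) (c : Config Reg σ) : Prop where
  lt : c.LT M
  Q : c.mem .Q = Q₀
  K : c.mem .K = stackCode Q₀ ps
  cnt : c.mem .cnt = k

theorem Env.step (hσ : σ < M) (h : Env M Q₀ k ps c) (hb : Big off M evalStep c c') :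
    Env M Q₀ k ps c' :=
  ⟨hb.lt hσ h.lt, (hb.frame.mem _ (by decide)).trans h.Q, (hb.frame.mem _ (by decide)).trans h.K,
    (hb.frame.mem _ (by decide)).trans h.cnt⟩

/-- Some number of steps of the evaluation lead from one configuration to the other. -/
def Reaches (off : List (Fin σ)) (M : ℕ) : Config Reg σ → Config Reg σ → Prop :=
  Relation.ReflTransGen fun c c' => evalCond.eval off c.mem ≠ 0 ∧ Big off M evalStep c c'

/-- A finished evaluation with the value `v` and the stack of calls `S`. -/
structure Returned (off : List (Fin σ)) (M Q₀ k : ℕ) (ps : List (ℕ × ℕ)) (c : Config Reg σ)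
    (v S : ℕ) (c' : Config Reg σ) : Prop where
  reaches : Reaches off M c c'
  env : Env M Q₀ k ps c'
  md : c'.mem .md = 1
  v : c'.mem .v = v
  S : c'.mem .S = S

/-- The state is at the start of an evaluation. -/
structure Called (c : Config Reg σ) (P l r a S : ℕ) : Prop where
  md : c.mem .md = 0
  P : c.mem .P = P
  l : c.mem .l = l
  r : c.mem .r = r
  a : c.mem .a = a
  S : c.mem .S = S

theorem evalCond_of_called {P l r a S : ℕ} (h : Called c P l r a S) :
    evalCond.eval off c.mem ≠ 0 := by
  simp [evalCond, Expr.eval, h.md]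

theorem Dispatched.called_first {f : Call} {S : ℕ} (h : Dispatched c Q₀ S f) (hi : f.i % 2 = 0) :
    Called c (f.P / 2) (f.l + f.i / 2) f.r f.a (f.push Q₀ S) :=
  ⟨h.md, h.P, (h.first hi).1, (h.first hi).2.1, (h.first hi).2.2, h.S⟩

theorem Dispatched.called_second {f : Call} {S : ℕ} (h : Dispatched c Q₀ S f) (hi : f.i % 2 ≠ 0) :
    Called c (f.P / 2) f.l (f.l + f.i / 2) (f.a + f.P / 2) (f.push Q₀ S) :=
  ⟨h.md, h.P, (h.second hi).1, (h.second hi).2.1, (h.second hi).2.2, h.S⟩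

theorem Call.next_even {f : Call} (h : f.i % 2 = 0) (v : ℕ) :
    f.next v = { f with i := f.i + 1, u := v } := if_pos h

theorem Call.next_odd {f : Call} (h : f.i % 2 ≠ 0) (v : ℕ) :
    f.next v = { f with i := f.i + 1, bs := min f.bs (f.u + v) } := if_neg h

/-- The returned value of a recursive call is passed to the call that is on top of the stack. -/
theorem Returned.resume {f : Call} {S₀ e v₀ : ℕ} {c₀ : Config Reg σ} (hσ : σ < M) (hM : 2 ≤ M)
    (h : Returned off M Q₀ k ps c₀ v₀ (f.push Q₀ S₀) c) (hf : f.LT Q₀)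
    (hf' : (f.next v₀).LT Q₀) (hS₀ : S₀ < Q₀ ^ e) (he : Q₀ ^ (e + 7) ≤ M) (hP : 0 < f.P)
    (h1 : f.l + (f.i + 1) / 2 < M) (h2 : f.a + f.P / 2 < M) :
    ∃ c', Reaches off M c₀ c' ∧ Env M Q₀ k ps c' ∧
      ((f.next v₀).i < 2 * (f.r - f.l) + 2 → Dispatched c' Q₀ S₀ (f.next v₀)) ∧
      (2 * (f.r - f.l) + 2 ≤ (f.next v₀).i →
        Returned off M Q₀ k ps c₀ (f.next v₀).bs S₀ c') := by
  have hQ := h.env.Q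
  obtain ⟨c', hb, h3, h4⟩ := wp_resume (off := off) (e := e) (S₀ := S₀) (f := f) hσ h.env.lt hM
    (by rwa [hQ]) (by rwa [hQ, h.v]) (by rwa [hQ]) (by rwa [hQ]) (by rw [hQ, h.S]) h1 h2
  rw [hQ, h.v] at h3
  rw [h.v] at h4
  have hstep : Big off M evalStep c c' := .ite_true _ _ _ _ _ (by simp [Expr.eval, h.md]) hb
  have hcond : evalCond.eval off c.mem ≠ 0 := by
    have := f.push_pos (S := S₀) (Q := Q₀) hP (by have := hf.P; omega)
    simp only [evalCond, Expr.eval, h.S]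
    omega
  have hr : Reaches off M c₀ c' := h.reaches.tail ⟨hcond, hstep⟩
  have henv := h.env.step hσ hstep
  exact ⟨c', hr, henv, h3, fun hi =>
    ⟨hr, henv, (h4 hi).2.2.trans h.md, (h4 hi).1, (h4 hi).2.1⟩⟩

theorem Returned.trans {c₀ : Config Reg σ} {v S : ℕ} (h : Returned off M Q₀ k ps c v S c')
    (h₀ : Reaches off M c₀ c) : Returned off M Q₀ k ps c₀ v S c' :=
  ⟨h₀.trans h.reaches, h.env, h.md, h.v, h.S⟩

set_option maxHeartbeats 1000000 in
-- Induction on the depth `h`, for a segment of length `2 ^ h`: the distance is the minimum over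
-- cuts `m` of the distances of the two halves. `hQ` makes the counter, which reaches `2 * (r - l) +
-- 2`, a base-`Q₀` digit, and `hA` does so for the distances.
theorem exists_returned (hσ : σ < M) (hM : 2 ≤ M) (hps : Valid off.length ps) {A : ℕ}
    (hQ : 2 * off.length + 3 ≤ Q₀) (hA : off.length + A + 1 < Q₀) (h : ℕ) :
    ∀ (c : Config Reg σ) (l r a S₀ e : ℕ), Env M Q₀ k ps c → Called c (2 ^ h) l r a S₀ →
      l ≤ r → r ≤ off.length → a + 2 ^ h ≤ A → S₀ < Q₀ ^ e → Q₀ ^ (e + 7 * h + 1) ≤ M →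
      ∃ c', Returned off M Q₀ k ps c
        (ed (sub off l r) (seg (pieces off (ps.take k)) a (2 ^ h))) S₀ c' := by
  generalize hU : pieces off (ps.take k) = U
  induction h with
  | zero =>
    intro c l r a S₀ e henv hcall hlr hr ha hS₀ he
    have hleaf := wp_leafCost (off := off) (ps := ps) hσ hM henv.lt (by rw [henv.Q]; omega)
      (by rw [henv.K, henv.Q]) hps (by rwa [hcall.l, hcall.r]) (by rwa [hcall.r])
    obtain ⟨c', hb, h1, h2⟩ := hleaf
    rw [hcall.l, hcall.r, henv.cnt, hcall.a, hU] at h2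
    have hstep : Big off M evalStep c c' := .ite_false _ _ _ _ _ (by simp [Expr.eval, hcall.md])
      (.ite_false _ _ _ _ _ (by simp [Expr.eval, hcall.P]) hb)
    exact ⟨c', .single ⟨evalCond_of_called hcall, hstep⟩, henv.step hσ hstep, h1, by simpa using h2,
      (hb.frame.mem _ (by decide)).trans hcall.S⟩
  | succ h ih =>
    intro c l r a S₀ e henv hcall hlr hr ha hS₀ he
    have hP2 : 2 ^ (h + 1) / 2 = 2 ^ h := by rw [pow_succ]; omega
    have hPpos : 0 < 2 ^ h := by positivity
    have hpow : 2 ^ (h + 1) = 2 ^ h + 2 ^ h := by rw [pow_succ]; omega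
    have hQM : ∀ m, m ≤ e + 7 * (h + 1) + 1 → Q₀ ^ m ≤ M := fun m hm =>
      (Nat.pow_le_pow_right (by omega) hm).trans he
    have hQM1 : Q₀ ≤ M := by simpa using hQM 1 (by omega)
    have hcost : ∀ x y b P, y ≤ off.length → ed (sub off x y) (seg U b P) ≤ (y - x) + P := by
      intro x y b P hy
      have h1 := ed_le_length_add (sub off x y) (seg U b P)
      have h2 := length_seg_le U b P
      rw [length_sub off x y hy] at h1
      omega
    set best := ed (sub off l r) (seg U a (2 ^ (h + 1))) with hbest
    have hsplit : seg U a (2 ^ (h + 1)) = seg U (a + 2 ^ h) (2 ^ h) ++ seg U a (2 ^ h) := by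
      rw [hpow, seg_add]
    -- `Q₀ - 1` is the starting value of `bs` and plays the part of infinity.
    have hbestQ : best ≤ Q₀ - 1 := by
      have := hcost l r a (2 ^ (h + 1)) hr
      omega
    generalize hcostd : (fun m => ed (sub off m r) (seg U a (2 ^ h)) +
      ed (sub off l m) (seg U (a + 2 ^ h) (2 ^ h))) = cost
    -- The cut about to be tried is `r - d`. The running minimum never drops below `best`, and
    -- `best` is attained by it or by a cut still to come; after the last cut the two agree.
    have loop : ∀ d (c : Config Reg σ) (f : Call), f.i = 2 * (r - l - d) → d ≤ r - l →
        Env M Q₀ k ps c → Dispatched c Q₀ S₀ f → f.P = 2 ^ (h + 1) → f.l = l → f.r = r →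
        f.a = a → f.bs < Q₀ → f.u < Q₀ → best ≤ f.bs →
        AttainedBy cost (r - d) r f.bs best →
        ∃ c', Returned off M Q₀ k ps c best S₀ c' := by
      intro d
      induction d using Nat.strong_induction_on with
      | _ d ihd =>
        intro c f hfi hd henv hdisp hfP hfl hfr hfa hfbs hfu hle hopt
        have hfLT : f.LT Q₀ := by constructor <;> omega
        have hi : f.i % 2 = 0 := by omega
        have hm : l + f.i / 2 = r - d := by omega
        have hcall1 := hdisp.called_first hi
        rw [hfP, hP2, hfl, hfr, hfa, hm] at hcall1
        obtain ⟨c1, h1⟩ := ih c _ _ _ _ (e + 7) henv hcall1 (by omega) hr (by omega)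
          (Call.push_lt hfLT hS₀) (by rwa [show e + 7 + 7 * h + 1 = e + 7 * (h + 1) + 1 by omega])
        have hv1 := hcost (r - d) r a (2 ^ h) hr
        generalize hv1' : ed (sub off (r - d) r) (seg U a (2 ^ h)) = v1 at *
        have hg := Call.next_even hi v1
        have hgLT : Call.LT { f with i := f.i + 1, u := v1 } Q₀ := by
          constructor <;> simp only <;> omega
        obtain ⟨c2, hr2, henv2, hd2, -⟩ := h1.resume (e := e) hσ hM hfLT (by rwa [hg]) hS₀
          (hQM _ (by omega)) (by omega) (by omega) (by omega)
        rw [hg] at hd2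
        generalize hgg : ({ f with i := f.i + 1, u := v1 } : Call) = g at *
        have hgi : g.i = f.i + 1 := by rw [← hgg]
        have hgl : g.l = l := by rw [← hgg]; exact hfl
        have hgr : g.r = r := by rw [← hgg]; exact hfr
        have hga : g.a = a := by rw [← hgg]; exact hfa
        have hgP : g.P = 2 ^ (h + 1) := by rw [← hgg]; exact hfP
        have hgu : g.u = v1 := by rw [← hgg]
        have hgb : g.bs = f.bs := by rw [← hgg]
        have hdisp2 := hd2 (by omega)
        have hi2 : g.i % 2 ≠ 0 := by omega
        have hcall2 := hdisp2.called_second hi2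
        rw [hgP, hP2, hgl, hga, show l + g.i / 2 = r - d by omega] at hcall2
        obtain ⟨c3, h3⟩ := ih c2 _ _ _ _ (e + 7) henv2 hcall2 (by omega) (by omega) (by omega)
          (Call.push_lt hgLT hS₀) (by rwa [show e + 7 + 7 * h + 1 = e + 7 * (h + 1) + 1 by omega])
        have hv2 := hcost l (r - d) (a + 2 ^ h) (2 ^ h) (by omega)
        have hbv : best ≤ v1 + ed (sub off l (r - d)) (seg U (a + 2 ^ h) (2 ^ h)) := by
          have := ed_sub_add_le off (show l ≤ r - d by omega) (show r - d ≤ r by omega)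
            (seg U (a + 2 ^ h) (2 ^ h)) (seg U a (2 ^ h))
          rw [hbest, hsplit, ← hv1']
          omega
        generalize hv2' : ed (sub off l (r - d)) (seg U (a + 2 ^ h) (2 ^ h)) = v2 at *
        have hcm : cost (r - d) = v1 + v2 := by rw [← hcostd, ← hv1', ← hv2']
        have hk := Call.next_odd hi2 v2
        have hkLT : Call.LT { g with i := g.i + 1, bs := min g.bs (g.u + v2) } Q₀ := by
          have := hgLT.u
          constructor <;> simp only <;> omega
        obtain ⟨c4, hr4, henv4, hd4, hend⟩ := h3.resume (e := e) hσ hM hgLT (by rwa [hk]) hS₀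
          (hQM _ (by omega)) (by omega) (by omega) (by omega)
        rw [hk] at hd4 hend
        simp only [hgi, hgu, hgb, hgr, hgl] at hd4 hend
        by_cases hd0 : d = 0
        · have h5 := hend (by omega)
          have : min f.bs (v1 + v2) = best := by
            refine le_antisymm ?_ (by omega)
            rw [← hcm]
            subst hd0
            exact hopt.last
          rw [this] at h5
          exact ⟨c4, h5.trans hr2⟩
        · obtain ⟨c5, h5⟩ := ihd (d - 1) (by omega) c4 _ (by simp only; omega) (by omega) henv4
            (hd4 (by omega)) hgP rfl rfl hga (by simp only; omega) (by simp only; omega)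
            (by simp only; omega) (by
              rw [← hcm, show r - (d - 1) = r - d + 1 by omega]
              exact hopt.next)
          exact ⟨c5, h5.trans (hr2.trans hr4)⟩
    have hc1 := ((henv.lt.set i (show 0 < M by omega)).set bs (show Q₀ - 1 < M by omega)).set u
      (show 0 < M by omega)
    have hQ1 : (((c.set i 0).set bs (Q₀ - 1)).set u 0).mem Q = Q₀ := by
      simp [Config.set_mem, henv.Q]
    have hdisp := wp_dispatch (off := off) (M := M) (e := e) (S₀ := S₀)
      (f := ⟨2 ^ (h + 1), l, r, a, 0, Q₀ - 1, 0⟩) hc1 hM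
      (by rw [hQ1]; constructor <;> simp only <;> omega)
      (by rwa [hQ1]) (by rw [hQ1]; exact hQM _ (by omega))
      (by constructor <;> simp [Config.set_mem, hcall.P, hcall.l, hcall.r, hcall.a, hcall.S])
      (by simp only; omega) (by simp only; omega)
    rw [hQ1] at hdisp
    have henter : WP off M evalStep (fun c' => Dispatched c' Q₀ S₀
        ⟨2 ^ (h + 1), l, r, a, 0, Q₀ - 1, 0⟩) c := by
      simp only [evalStep, enter, Cmd.block, wp_ite, wp_seq, wp_assign, Expr.eval,
        Config.set_mem, reduceCtorEq, if_false, hcall.md, hcall.P, henv.Q]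
      exact ⟨fun h => absurd rfl h, fun _ => ⟨fun _ => ⟨by omega, by omega, by omega, hdisp⟩,
        fun h => by omega⟩⟩
    obtain ⟨c1, hstep, h1⟩ := henter
    obtain ⟨c2, h2⟩ := loop (r - l) c1 _ (by simp) le_rfl (henv.step hσ hstep) h1 rfl rfl rfl rfl
      (by simp only; omega) (by simp only; omega) hbestQ (by
        -- Before the first cut all of them lie ahead, and splitting an optimal alignment exhibits
        -- an optimal one.
        obtain ⟨m, hm1, hm2, hm3⟩ := ed_sub_split off hlr hr (seg U (a + 2 ^ h) (2 ^ h))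
          (seg U a (2 ^ h))
        exact .inr ⟨m, by omega, hm2, by
          rw [hbest, hsplit, ← hcostd]
          exact (add_comm _ _).trans_le hm3⟩)
    exact ⟨c2, h2.trans (.single ⟨evalCond_of_called hcall, hstep⟩)⟩

end Reg

/-! ### Search for a nearest substring. -/

/-- The concatenation of the substrings on a stack, whose top comes last. -/
def str {α : Type} (s : List α) (ps : List (ℕ × ℕ)) : List α := (pieces s ps).reverse

theorem str_cons {α : Type} (s : List α) (p : ℕ × ℕ) (ps : List (ℕ × ℕ)) :
    str s (p :: ps) = str s ps ++ sub s p.1 p.2 := by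
  simp [str, pieces]

theorem seg_zero_eq_reverse {α : Type} {U : List α} {P : ℕ} (h : U.length ≤ P) :
    seg U 0 P = U.reverse := by
  rw [seg, List.drop_zero, List.take_of_length_le h]

theorem stackCode_lt {Q N : ℕ} (hQ : N < Q) {ps : List (ℕ × ℕ)}
    (h : ∀ p ∈ ps, p.1 ≤ p.2 ∧ p.2 ≤ N) : stackCode Q ps < Q ^ (2 * ps.length) := by
  induction ps with
  | nil => simp [stackCode]
  | cons p ps ih =>
    have hp := h p (by simp)
    exact Reg.mul_add_lt_pow (by omega)
      (Reg.mul_add_lt_pow (by omega) (ih fun q hq => h q (by simp [hq])))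

/-- `p` is a nearest substring of `s` to `t`, at distance `v`. -/
structure IsNearest {α : Type} (s t : List α) (p : ℕ × ℕ) (v : ℕ) : Prop where
  le : p.1 ≤ p.2
  le_length : p.2 ≤ s.length
  eq : v = ed (sub s p.1 p.2) t
  min : ∀ l r, l ≤ r → r ≤ s.length → v ≤ ed (sub s l r) t

namespace Reg

variable {σ : ℕ} {off : List (Fin σ)} {M Q₀ H k : ℕ} {ps : List (ℕ × ℕ)} {c c' : Config Reg σ}

/-- The bounds under which the procedures work. -/
structure Params (off : List (Fin σ)) (M Q₀ H : ℕ) : Prop where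
  alphabet : σ < M
  two_le : 2 ≤ M
  two_mul : 2 * off.length + 3 ≤ Q₀
  add_pow : off.length + 2 ^ H + 1 < Q₀
  pow_le : Q₀ ^ (7 * H + 1) ≤ M

theorem Params.base_le (h : Params off M Q₀ H) : Q₀ ≤ M :=
  (Nat.le_self_pow (by omega) _).trans h.pow_le

theorem Reaches.big (h : Reaches off M c c') (he : evalCond.eval off c'.mem = 0) :
    Big off M (.while evalCond evalStep) c c' := by
  induction h using Relation.ReflTransGen.head_induction_on with
  | refl => exact .while_false _ _ _ he
  | head h _ ih => exact .while_true _ _ _ _ _ h.1 h.2 ih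

/-- The segment of length `2 ^ H` from offset 0 is the whole string, by `hlen`; the recursion starts
on an empty call stack. -/
theorem wp_evalDist (hp : Params off M Q₀ H) (hc : Env M Q₀ k ps c) (hP0 : c.mem P0 = 2 ^ H)
    (hps : Valid off.length ps) (hlr : c.mem l ≤ c.mem r) (hr : c.mem r ≤ off.length)
    (hlen : (str off (ps.take k)).length ≤ 2 ^ H) :
    WP off M evalDist (fun c' => c'.mem v = ed (sub off (c.mem l) (c.mem r))
      (str off (ps.take k))) c := by
  have h2 := hp.two_le
  have hPM : 2 ^ H < M := by have := hp.base_le; have := hp.add_pow; omega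
  have hlt : ((((c.set P (2 ^ H)).set a 0).set md 0).set S 0).LT M :=
    (((hc.lt.set _ hPM).set _ (by omega)).set _ (by omega)).set _ (by omega)
  obtain ⟨c', h⟩ := exists_returned (k := k) hp.alphabet h2 hps hp.two_mul (A := 2 ^ H)
    (by have := hp.add_pow; omega) H ((((c.set P (2 ^ H)).set a 0).set md 0).set S 0)
    (c.mem l) (c.mem r) 0 0 0
    ⟨hlt, by simp [Config.set_mem, hc.Q], by simp [Config.set_mem, hc.K],
      by simp [Config.set_mem, hc.cnt]⟩
    (by constructor <;> simp [Config.set_mem]) hlr hr (by omega) (by simp)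
    (by simpa using hp.pow_le)
  rw [seg_zero_eq_reverse (by simpa [str] using hlen)] at h
  simp only [evalDist, Cmd.block, wp_seq, wp_assign, Expr.eval, hP0]
  exact ⟨hPM, by omega, by omega, by omega, c', h.reaches.big (by simp [evalCond, Expr.eval, h.md, h.S]),
    h.v⟩

/-- The registers that are fixed while the strings are compared. -/
structure Consts (off : List (Fin σ)) (M Q₀ H : ℕ) (c : Config Reg σ) : Prop where
  lt : c.LT M
  n : c.mem .n = off.length
  Q : c.mem .Q = Q₀
  P0 : c.mem .P0 = 2 ^ H

theorem Consts.frame (h : Consts off M Q₀ H c) (hlt : c'.LT M) {p : Cmd Reg} (hf : Frame p c c')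
    (h1 : Reg.n ∉ p.writes := by decide) (h2 : Reg.Q ∉ p.writes := by decide)
    (h3 : Reg.P0 ∉ p.writes := by decide) : Consts off M Q₀ H c' :=
  ⟨hlt, (hf.mem _ h1).trans h.n, (hf.mem _ h2).trans h.Q, (hf.mem _ h3).trans h.P0⟩

theorem wp_nearest (hp : Params off M Q₀ H) (hc : Consts off M Q₀ H c)
    (hK : c.mem K = stackCode Q₀ ps) (hcnt : c.mem cnt = k) (hps : Valid off.length ps)
    (hlen : (str off (ps.take k)).length ≤ 2 ^ H) :
    WP off M nearest (fun c' =>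
      IsNearest off (str off (ps.take k)) (c'.mem bl, c'.mem br) (c'.mem bv)) c := by
  generalize hW : str off (ps.take k) = W at *
  have hadd := hp.add_pow
  have hQM := hp.base_le
  have hσ := hp.alphabet
  have hcost : ∀ l r, r ≤ off.length → ed (sub off l r) W < Q₀ - 1 := by
    intro l r hr
    have h1 := ed_le_length_add (sub off l r) W
    rw [length_sub off l r hr] at h1
    omega
  -- The value `Q₀ - 1` means that no candidate has been recorded; by `hcost` every true distance is
  -- strictly smaller.
  let Best (c' : Config Reg σ) : Prop := c'.mem bv = Q₀ - 1 ∨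
    c'.mem bl ≤ c'.mem br ∧ c'.mem br ≤ off.length ∧
      c'.mem bv = ed (sub off (c'.mem bl) (c'.mem br)) W
  simp only [nearest, Cmd.block, wp_seq, wp_assign, Expr.eval, hc.Q]
  refine ⟨by omega, by omega, ?_⟩
  refine wp_while hσ ((hc.lt.set _ (by omega)).set _ (by omega))
    (fun m c' => m + c'.mem l0 = off.length + 1 ∧ Best c' ∧
      ∀ l < c'.mem l0, ∀ r, l ≤ r → r ≤ off.length → c'.mem bv ≤ ed (sub off l r) W)
    (m₀ := off.length + 1) ?_ ?_ ?_
  · simp [Config.set_mem, Best]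
  · rintro m c1 hc1 hf1 ⟨hm, hbest, hmin⟩ he
    have hn1 : c1.mem n = off.length := by
      rw [hf1.mem n (by decide)]; simp [Config.set_mem, hc.n]
    simp only [Expr.eval, hn1] at he
    simp only [wp_seq, wp_assign, Expr.eval, Config.set_mem, reduceCtorEq, if_false]
    refine ⟨hc1 _, ?_⟩
    refine wp_while hσ (hc1.set _ (hc1 _))
      (fun m' c' => m' + c'.mem r0 = off.length + 1 ∧ c1.mem l0 ≤ c'.mem r0 ∧ Best c' ∧
        (∀ l < c1.mem l0, ∀ r, l ≤ r → r ≤ off.length → c'.mem bv ≤ ed (sub off l r) W) ∧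
        ∀ r < c'.mem r0, c1.mem l0 ≤ r → c'.mem bv ≤ ed (sub off (c1.mem l0) r) W)
      (m₀ := off.length + 1 - c1.mem l0) ?_ ?_ ?_
    · simp only [Config.set_mem, reduceCtorEq, if_false, if_true, Best]
      exact ⟨by omega, le_rfl, hbest, hmin, fun r h1 h2 => by omega⟩
    · rintro m' c2 hc2 hf2 ⟨hm', hlr, hbest', hmin', hminr⟩ he'
      have hn2 : c2.mem n = off.length := by
        rw [hf2.mem n (by decide)]; simp [Config.set_mem, hn1]
      have hl2 : c2.mem l0 = c1.mem l0 := by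
        rw [hf2.mem l0 (by decide)]; simp [Config.set_mem]
      have hQ2 : c2.mem Q = Q₀ := by
        rw [hf2.mem Q (by decide), Config.set_mem, if_neg (by decide), hf1.mem Q (by decide)]
        simp [Config.set_mem, hc.Q]
      have hP2 : c2.mem P0 = 2 ^ H := by
        rw [hf2.mem P0 (by decide), Config.set_mem, if_neg (by decide), hf1.mem P0 (by decide)]
        simp [Config.set_mem, hc.P0]
      have hK2 : c2.mem K = stackCode Q₀ ps := by
        rw [hf2.mem K (by decide), Config.set_mem, if_neg (by decide), hf1.mem K (by decide)]
        simp [Config.set_mem, hK]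
      have hcnt2 : c2.mem cnt = k := by
        rw [hf2.mem cnt (by decide), Config.set_mem, if_neg (by decide), hf1.mem cnt (by decide)]
        simp [Config.set_mem, hcnt]
      simp only [Expr.eval, hn2] at he'
      simp only [wp_seq, wp_assign, Expr.eval, Config.set_mem, reduceCtorEq, if_false]
      refine ⟨hc2 _, hc2 _, ?_⟩
      have hlt3 := (hc2.set l (hc2 l0)).set r (hc2 r0)
      refine (wp_evalDist (k := k) (ps := ps) hp
        ⟨hlt3, by simp [Config.set_mem, hQ2], by simp [Config.set_mem, hK2],
          by simp [Config.set_mem, hcnt2]⟩ (by simp [Config.set_mem, hP2]) hps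
        (by simp [Config.set_mem]; omega) (by simp [Config.set_mem]; omega)
        (by rwa [hW])).imp hσ hlt3 fun c3 hc3 hf3 hv => ?_
      simp only [Config.set_mem, reduceCtorEq, if_false, if_true, hl2] at hv
      have e1 : c3.mem l0 = c1.mem l0 := by
        rw [hf3.mem l0 (by decide)]; simp [Config.set_mem, hl2]
      have e2 : c3.mem r0 = c2.mem r0 := by rw [hf3.mem r0 (by decide)]; simp [Config.set_mem]
      have e3 : c3.mem bv = c2.mem bv := by rw [hf3.mem bv (by decide)]; simp [Config.set_mem]
      have e4 : c3.mem bl = c2.mem bl := by rw [hf3.mem bl (by decide)]; simp [Config.set_mem]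
      have e5 : c3.mem br = c2.mem br := by rw [hf3.mem br (by decide)]; simp [Config.set_mem]
      rw [hW] at hv
      have hvQ := hcost (c1.mem l0) (c2.mem r0) (by omega)
      simp only [wp_ite, wp_seq, wp_assign, wp_skip, Expr.eval, Config.set_mem, reduceCtorEq,
        if_false, if_true, e1, e2, e3, Best, hv, e4, e5]
      have hl1 := hc1 l0
      have hr2 := hc2 r0
      refine ⟨fun h => ⟨by omega, by omega, by omega, by omega, m' - 1, by omega, by omega,
        by omega, .inr ⟨hlr, by omega, trivial⟩, fun l hl r hr hr' => ?_, fun r hr hr' => ?_⟩,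
        fun h => ⟨by omega, m' - 1, by omega, by omega, by omega, hbest', hmin',
          fun r hr hr' => ?_⟩⟩
      · have := hmin' l hl r hr hr'
        omega
      · rcases Nat.lt_succ_iff_lt_or_eq.1 hr with h3 | rfl
        · have := hminr r h3 hr'
          omega
        · exact le_rfl
      · rcases Nat.lt_succ_iff_lt_or_eq.1 hr with h3 | rfl
        · exact hminr r h3 hr'
        · omega
    · rintro m' c2 hc2 hf2 ⟨hm', hlr, hbest', hmin', hminr⟩ he'
      have hn2 : c2.mem n = off.length := by
        rw [hf2.mem n (by decide)]; simp [Config.set_mem, hn1]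
      have hl2 : c2.mem l0 = c1.mem l0 := by
        rw [hf2.mem l0 (by decide)]; simp [Config.set_mem]
      simp only [Expr.eval, hn2] at he'
      simp only [Config.set_mem, reduceCtorEq, if_false, if_true, Best, hl2]
      refine ⟨by omega, m - 1, by omega, by omega, hbest', fun l hl r hr hr' => ?_⟩
      rcases Nat.lt_succ_iff_lt_or_eq.1 hl with h3 | rfl
      · exact hmin' l h3 r hr hr'
      · exact hminr r (by omega) hr
  · rintro m c1 hc1 hf1 ⟨hm, hbest, hmin⟩ he
    have hn1 : c1.mem n = off.length := by
      rw [hf1.mem n (by decide)]; simp [Config.set_mem, hc.n]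
    simp only [Expr.eval, hn1] at he
    have hmin' : ∀ l r, l ≤ r → r ≤ off.length → c1.mem bv ≤ ed (sub off l r) W :=
      fun l r hl hr => hmin l (by omega) r hl hr
    -- The initial value cannot have survived, since the empty substring at 0 was a candidate.
    rcases hbest with hb | ⟨h1, h2, h3⟩
    · have h1 := hcost 0 0 (by omega)
      have h2 := hmin' 0 0 le_rfl (by omega)
      omega
    · exact ⟨h1, h2, h3, hmin'⟩

end Reg

/-! ### The approximation factor and the hierarchy of blocks. -/

section Levels

variable {α : Type} {s : List α}

/-- `x` is represented by a substring of `s`, at distance at most `e`, and no substring of `s` is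
nearer to `x` than `e / K`. -/
structure Good (s : List α) (K : ℕ) (p : ℕ × ℕ) (x : List α) (e : ℕ) : Prop where
  le : p.1 ≤ p.2
  le_length : p.2 ≤ s.length
  ed_le : ed (sub s p.1 p.2) x ≤ e
  opt : ∀ l r, l ≤ r → r ≤ s.length → e ≤ K * ed (sub s l r) x

/-- A stack of substrings that represent the parts of `x`, with total estimate `e`. -/
inductive Rep (s : List α) (K : ℕ) : List (ℕ × ℕ) → List α → ℕ → Prop
  | nil : Rep s K [] [] 0
  | cons (p ps x y e e') : Good s K p y e → Rep s K ps x e' → Rep s K (p :: ps) (x ++ y) (e' + e)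

theorem Good.mono {K K' : ℕ} (hK : K ≤ K') {p : ℕ × ℕ} {x : List α} {e : ℕ} (h : Good s K p x e) :
    Good s K' p x e :=
  ⟨h.le, h.le_length, h.ed_le, fun l r hl hr =>
    (h.opt l r hl hr).trans (Nat.mul_le_mul_right _ hK)⟩

namespace Rep

variable {K K' e : ℕ} {ps : List (ℕ × ℕ)} {x : List α}

theorem mono (hK : K ≤ K') (h : Rep s K ps x e) : Rep s K' ps x e := by
  induction h with
  | nil => exact .nil
  | cons p ps x y e e' hg _ ih => exact .cons _ _ _ _ _ _ (hg.mono hK) ih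

theorem append {qs : List (ℕ × ℕ)} {y : List α} {e' : ℕ} (h : Rep s K ps x e)
    (h' : Rep s K qs y e') : Rep s K (ps ++ qs) (y ++ x) (e' + e) := by
  induction h with
  | nil => simpa using h'
  | cons p ps x y' e e'' hg _ ih =>
    rw [← List.append_assoc, ← add_assoc]
    exact .cons _ _ _ _ _ _ hg ih

theorem valid (h : Rep s K ps x e) : ∀ p ∈ ps, p.1 ≤ p.2 ∧ p.2 ≤ s.length := by
  induction h with
  | nil => simp
  | cons p ps x y e e' hg _ ih =>
    rintro q hq
    rcases List.mem_cons.1 hq with rfl | hq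
    exacts [⟨hg.le, hg.le_length⟩, ih q hq]

theorem ed_le (h : Rep s K ps x e) : ed (str s ps) x ≤ e := by
  induction h with
  | nil => simp [str, pieces, ed_self]
  | cons p ps x y e e' hg _ ih =>
    rw [str_cons]
    exact (ed_append_le _ _ _ _).trans (add_le_add ih hg.ed_le)

/-- An optimal alignment of `sub s l r` with `x ++ y` cuts it into substrings aligned with `x` and
`y`, and the two lower bounds add. So concatenation costs no loss in `K`. -/
theorem opt (h : Rep s K ps x e) :
    ∀ l r, l ≤ r → r ≤ s.length → e ≤ K * ed (sub s l r) x := by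
  induction h with
  | nil => simp
  | cons p ps x y e e' hg _ ih =>
    intro l r hl hr
    obtain ⟨m, h1, h2, h3⟩ := ed_sub_split s hl hr x y
    have h4 := ih l m h1 (by omega)
    have h5 := hg.opt m r h2 hr
    calc e' + e ≤ K * (ed (sub s l m) x + ed (sub s m r) y) := by rw [mul_add]; omega
      _ ≤ _ := Nat.mul_le_mul_left _ h3

/-- A substring nearest to the concatenation of the representing substrings represents the
whole string. -/
theorem merge (h : Rep s K ps x e) {p : ℕ × ℕ} {v : ℕ} (hp : IsNearest s (str s ps) p v) :
    Good s (2 * K + 1) p x (e + v) := by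
  refine ⟨hp.le, hp.le_length, ?_, fun l r hl hr => ?_⟩
  · have h1 := ed_triangle (sub s p.1 p.2) (str s ps) x
    have h2 := h.ed_le
    have h3 := hp.eq
    omega
  -- With `D = ed (sub s l r) x`: minimality gives `v ≤ ed (sub s l r) (str s ps) ≤ D + e`, hence `e
  -- + v ≤ 2 * e + D ≤ (2 * K + 1) * D`.
  · have h1 := ed_triangle (sub s l r) x (str s ps)
    have h2 := h.ed_le
    have h3 := hp.min l r hl hr
    have h4 := h.opt l r hl hr
    rw [ed_comm x] at h1
    rw [add_mul, mul_assoc]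
    omega

/-- Comparison with the empty substring; this keeps the register `E` small. -/
theorem le_mul_length (h : Rep s K ps x e) : e ≤ K * x.length := by
  have := h.opt 0 0 le_rfl (by omega)
  rwa [sub_self, ed_comm, ed_nil] at this

theorem length_str_le (h : Rep s K ps x e) : (str s ps).length ≤ ps.length * s.length := by
  induction h with
  | nil => simp [str, pieces]
  | cons p ps x y e e' hg _ ih =>
    have := hg.le_length
    rw [str_cons, List.length_append, length_sub _ _ _ hg.le_length, List.length_cons, add_mul]
    omega

end Rep

/-- The approximation factor of the representation of blocks at level `j`. -/
def factor (j : ℕ) : ℕ := 2 ^ (j + 1) - 1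

theorem factor_succ (j : ℕ) : factor (j + 1) = 2 * factor j + 1 := by
  have : 0 < 2 ^ (j + 1) := by positivity
  rw [factor, factor, pow_succ 2 (j + 1)]
  omega

theorem factor_mono : Monotone factor := fun _ _ h =>
  Nat.sub_le_sub_right (Nat.pow_le_pow_right (by omega) (by omega)) 1

/-- A stack whose levels from `j` on represent `q` blocks of level `j`, with the digits of `q` in
base `B` counting the entries of the levels. -/
inductive Stack (s : List α) (B : ℕ) : ℕ → List (ℕ × ℕ) → ℕ → List α → ℕ → Prop
  | empty (j) : Stack s B j [] 0 [] 0
  | level (j top rest q x y e e') : Rep s (factor j) top y e → top.length = q % B →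
      Stack s B (j + 1) rest (q / B) x e' → Stack s B j (top ++ rest) q (x ++ y) (e' + e)

/-- As `Stack`, but the block of level `j` that came last has not been carried, so that the
level `j` may have `B` entries. -/
structure Pending (s : List α) (B j : ℕ) (st : List (ℕ × ℕ)) (q : ℕ) (x : List α) (E : ℕ)
    (top rest : List (ℕ × ℕ)) (y z : List α) (e e' : ℕ) : Prop where
  stack_eq : st = top ++ rest
  str_eq : x = z ++ y
  est_eq : E = e' + e
  rep : Rep s (factor j) top y e
  length : top.length = (q - 1) % B + 1
  stack : Stack s B (j + 1) rest ((q - 1) / B) z e'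
  pos : 0 < q

namespace Stack

variable {B j q E : ℕ} {st : List (ℕ × ℕ)} {x : List α}

theorem split (h : Stack s B j st q x E) : ∃ top rest y z e e', st = top ++ rest ∧ x = z ++ y ∧
    E = e' + e ∧ Rep s (factor j) top y e ∧ top.length = q % B ∧
      Stack s B (j + 1) rest (q / B) z e' := by
  cases h with
  | empty => exact ⟨[], [], [], [], 0, 0, rfl, rfl, rfl, .nil, by simp, by simpa using .empty _⟩
  | level _ top rest _ x y e e' h1 h2 h3 => exact ⟨top, rest, y, x, e, e', rfl, rfl, rfl, h1, h2, h3⟩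

theorem shift (hB : 0 < B) (h : Stack s B (j + 1) st q x E) : Stack s B j st (q * B) x E := by
  have : Stack s B j ([] ++ st) (q * B) (x ++ []) (E + 0) :=
    .level j [] st (q * B) x [] 0 E .nil (by simp) (by rwa [Nat.mul_div_cancel _ hB])
  simpa using this

/-- After carries up to level `j` all lower levels are empty, like the trailing zero digits of the
counter. -/
theorem shift_zero (hB : 0 < B) (h : Stack s B j st q x E) : Stack s B 0 st (q * B ^ j) x E := by
  induction j generalizing q with
  | zero => simpa using h
  | succ j ih => rw [pow_succ', ← mul_assoc]; exact ih (h.shift hB)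

theorem length_le (hB : 2 ≤ B) (h : Stack s B j st q x E) : st.length ≤ q := by
  induction h with
  | empty => simp
  | level j top rest q x y e e' _ h2 _ ih =>
    have h3 := Nat.div_add_mod q B
    have h4 := Nat.mul_le_mul_right (q / B) (show 1 ≤ B by omega)
    rw [List.length_append]
    omega

theorem length_le_mul (h : Stack s B j st q x E) : ∀ i, q < B ^ i → st.length ≤ i * B := by
  induction h with
  | empty => simp
  | level j top rest q x y e e' _ h2 h3 ih =>
    rintro (_ | i) hq
    · obtain rfl : q = 0 := by simpa using hq
      have h4 : top = [] := by simpa using h2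
      have h5 := ih 0 (by simp)
      simpa [h4] using h5
    · have hB : 0 < B := by
        by_contra h0
        obtain rfl : B = 0 := by omega
        simp at hq
      have h4 := ih i (Nat.div_lt_of_lt_mul (by rwa [← pow_succ']))
      have h5 := Nat.mod_lt q hB
      rw [List.length_append, add_mul]
      omega

/-- A level `j` with `q > 0` satisfies `B ^ j ≤ B ^ k`, so all entries lie at levels at most `k`,
and their factors are at most `factor k`. -/
theorem rep (hB : 2 ≤ B) {k : ℕ} (h : Stack s B j st q x E) (hq : q * B ^ j ≤ B ^ k) :
    Rep s (factor k) st x E := by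
  induction h with
  | empty => exact .nil
  | level j top rest q x y e e' h1 h2 _ ih =>
    have h4 := ih (by
      rw [pow_succ', ← mul_assoc]
      exact (Nat.mul_le_mul_right _ (Nat.div_mul_le_self q B)).trans hq)
    refine Rep.append ?_ h4
    rcases Nat.eq_zero_or_pos q with rfl | h0
    · obtain rfl : top = [] := by simpa using h2
      cases h1
      exact .nil
    · have : B ^ j ≤ B ^ k := (Nat.le_mul_of_pos_left _ h0).trans hq
      exact h1.mono (factor_mono ((Nat.pow_le_pow_iff_right (by omega)).1 this))

theorem push (h : Stack s B 0 st q x E) {p : ℕ × ℕ} {y : List α} {e : ℕ}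
    (hp : Good s (factor 0) p y e) : ∃ top rest y' z e₁ e₂,
      Pending s B 0 (p :: st) (q + 1) (x ++ y) (E + e) top rest y' z e₁ e₂ := by
  obtain ⟨top, rest, y', z, e₁, e₂, rfl, rfl, rfl, h4, h5, h6⟩ := h.split
  exact ⟨p :: top, rest, y' ++ y, z, e₁ + e, e₂, rfl, by simp, by omega,
    .cons _ _ _ _ _ _ hp h4, by simpa using h5, by simpa using h6, by omega⟩

end Stack

namespace Pending

variable {B j q E e e' : ℕ} {st top rest : List (ℕ × ℕ)} {x y z : List α}

/-- If `B` does not divide `q`, then passing from `q - 1` to `q` changes only the last digit, and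
there is no carry. -/
theorem toStack (h : Pending s B j st q x E top rest y z e e') (hq : q % B ≠ 0) :
    Stack s B j st q x E := by
  obtain ⟨rfl, rfl, rfl, h4, h5, h6, h7⟩ := h
  obtain ⟨q, rfl⟩ := Nat.exists_eq_succ_of_ne_zero h7.ne'
  have hd : ¬ B ∣ q.succ := fun h => hq (Nat.mod_eq_zero_of_dvd h)
  have hdiv := Nat.succ_div_of_not_dvd hd
  have h1 := Nat.div_add_mod q B
  have h2 := Nat.div_add_mod q.succ B
  rw [Nat.succ_eq_add_one] at *
  rw [hdiv] at h2
  refine .level _ _ _ _ _ _ _ _ h4 ?_ (by rwa [hdiv])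
  rw [h5, Nat.add_sub_cancel]
  omega

theorem rep_all (hB : 2 ≤ B) {k : ℕ} (h : Pending s B j st q x E top rest y z e e')
    (hq : q * B ^ j ≤ B ^ k) : Rep s (factor k) st x E := by
  obtain ⟨rfl, rfl, rfl, h4, h5, h6, h7⟩ := h
  have : B ^ j ≤ B ^ k := (Nat.le_mul_of_pos_left _ h7).trans hq
  refine (h4.mono (factor_mono ((Nat.pow_le_pow_iff_right (by omega)).1 this))).append
    (h6.rep hB ?_)
  rw [pow_succ', ← mul_assoc]
  exact (Nat.mul_le_mul_right _ ((Nat.div_mul_le_self _ B).trans (Nat.sub_le _ _))).trans hq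

theorem length_le (hB : 2 ≤ B) {k : ℕ} (h : Pending s B j st q x E top rest y z e e')
    (hq : q ≤ B ^ k) : st.length ≤ (k + 1) * B := by
  obtain ⟨rfl, rfl, rfl, h4, h5, h6, h7⟩ := h
  have h8 := h6.length_le_mul k ((Nat.div_le_self _ _).trans_lt (by omega))
  have h9 := Nat.mod_lt (q - 1) (show 0 < B by omega)
  rw [List.length_append, add_mul]
  omega

theorem length_top (hB : 2 ≤ B) (h : Pending s B j st q x E top rest y z e e') (hq : q % B = 0) :
    top.length = B := by
  obtain ⟨q', rfl⟩ := Nat.dvd_of_mod_eq_zero hq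
  have h0 : 0 < q' := by
    rcases Nat.eq_zero_or_pos q' with rfl | h0
    · simpa using h.pos
    · exact h0
  obtain ⟨q', rfl⟩ := Nat.exists_eq_succ_of_ne_zero h0.ne'
  rw [h.length, Nat.mul_succ, show B * q' + B - 1 = B * q' + (B - 1) by omega, Nat.mul_add_mod,
    Nat.mod_eq_of_lt (by omega)]
  omega

/-- If `B` divides `q`, the level is full. Merging it empties the level and adds one entry to the
next, where the same situation arises with `q / B`; `factor_succ` matches the loss in `Rep.merge`.
-/
theorem carry (hB : 2 ≤ B) (h : Pending s B j st q x E top rest y z e e') (hq : q % B = 0)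
    {p : ℕ × ℕ} {v : ℕ} (hp : IsNearest s (str s top) p v) : ∃ top' rest' y' z' e₁ e₂,
      Pending s B (j + 1) (p :: rest) (q / B) x (E + v) top' rest' y' z' e₁ e₂ := by
  obtain ⟨rfl, rfl, rfl, h4, h5, h6, h7⟩ := h
  obtain ⟨top', rest', y', z', e₁, e₂, rfl, rfl, rfl, g4, g5, g6⟩ := h6.split
  have hg := h4.merge hp
  rw [← factor_succ] at hg
  obtain ⟨q', rfl⟩ := Nat.dvd_of_mod_eq_zero hq
  have h0 : 0 < q' := by
    rcases Nat.eq_zero_or_pos q' with rfl | h0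
    · simp at h7
    · exact h0
  have hdiv : (B * q' - 1) / B = q' - 1 := by
    obtain ⟨q', rfl⟩ := Nat.exists_eq_succ_of_ne_zero h0.ne'
    rw [Nat.mul_succ, show B * q' + B - 1 = B * q' + (B - 1) by omega,
      Nat.mul_add_div (by omega), Nat.div_eq_of_lt (by omega)]
    simp
  rw [hdiv] at g5 g6
  rw [Nat.mul_div_cancel_left _ (by omega)]
  exact ⟨p :: top', rest', y' ++ y, z', e₁ + (e + v), e₂, rfl, by simp, by omega,
    .cons _ _ _ _ _ _ hg g4, by simpa using g5, g6, h0⟩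

end Pending

end Levels

/-! ### Correctness of merging, reading and the preparations. -/

namespace Reg

variable {σ : ℕ} {off : List (Fin σ)} {M Q₀ H k B₀ : ℕ} {ps : List (ℕ × ℕ)} {c c' : Config Reg σ}

theorem wp_mergeTop (hp : Params off M Q₀ H) (hc : Consts off M Q₀ H c)
    {top rest : List (ℕ × ℕ)} (hK : c.mem K = stackCode Q₀ (top ++ rest))
    (hB : c.mem B = top.length) (hcnt : c.mem cnt = top.length)
    (hv : Valid off.length (top ++ rest)) (hlen : (str off top).length ≤ 2 ^ H)
    (hE : ∀ p v, IsNearest off (str off top) p v → c.mem E + v < M)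
    (hM : Q₀ ^ (2 * (rest.length + 1)) ≤ M) :
    WP off M mergeTop (fun c' => ∃ p v, IsNearest off (str off top) p v ∧
      c'.mem K = stackCode Q₀ (p :: rest) ∧ c'.mem E = c.mem E + v) c := by
  have hσ := hp.alphabet
  have hNQ : off.length < Q₀ := by have := hp.two_mul; omega
  simp only [mergeTop, Cmd.block, wp_seq, wp_assign, Expr.eval]
  refine (wp_nearest (k := top.length) hp hc hK hcnt hv
    (by rwa [List.take_left])).imp hσ hc.lt fun c1 hc1 hf1 h1 => ?_
  rw [List.take_left] at h1
  have e1 : c1.mem E = c.mem E := hf1.mem _ (by decide)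
  have e2 : c1.mem B = top.length := (hf1.mem _ (by decide)).trans hB
  have e3 : c1.mem K = stackCode Q₀ (top ++ rest) := (hf1.mem _ (by decide)).trans hK
  have e4 : c1.mem Q = Q₀ := (hf1.mem _ (by decide)).trans hc.Q
  have hE1 := hE _ _ h1
  have hB1 := hc1 B
  simp only [Config.set_mem, reduceCtorEq, if_false, e1]
  refine ⟨hE1, hB1, ?_⟩
  have hc2 := (hc1.set E hE1).set j hB1
  refine wp_while hσ hc2 (fun m c' => m = c'.mem j ∧ ∃ ps, ps.length = m ∧
    Valid off.length ps ∧ c'.mem K = stackCode Q₀ (ps ++ rest)) (m₀ := top.length) ?_ ?_ ?_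
  · simp only [Config.set_mem, reduceCtorEq, if_false, if_true, e2, e3]
    exact ⟨trivial, top, rfl, fun p h => hv p (by simp [h]), rfl⟩
  · rintro m c3 hc3 hf3 ⟨hm, ps, hps, hpv, hK3⟩ he
    have e5 : c3.mem Q = Q₀ := by
      rw [hf3.mem _ (by decide)]; simp [Config.set_mem, e4]
    simp only [Expr.eval, ← hm] at he
    have hKM := hc3 K
    have hdiv : ∀ x y, x < M → x / y < M := fun x y h => (Nat.div_le_self _ _).trans_lt h
    have hj := hc3 j
    simp only [wp_seq, wp_assign, Expr.eval, Config.set_mem, reduceCtorEq, if_false, if_true, e5]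
    refine ⟨hdiv _ _ (hdiv _ _ hKM), by omega, m - 1, by omega, by omega, ?_⟩
    cases ps with
    | nil => exact absurd hps.symm he
    | cons p ps =>
      have h6 := hpv p (by simp)
      refine ⟨ps, by simp [← hps], fun q hq => hpv q (by simp [hq]), ?_⟩
      rw [hK3, List.cons_append, stackCode, mul_add_div_base (by omega),
        mul_add_div_base (by omega)]
  · rintro m c3 hc3 hf3 ⟨hm, ps, hps, hpv, hK3⟩ he
    simp only [Expr.eval, ← hm] at he
    obtain rfl : ps = [] := List.length_eq_zero_iff.1 (hps.trans he)
    have e5 : c3.mem Q = Q₀ := by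
      rw [hf3.mem _ (by decide)]; simp [Config.set_mem, e4]
    have e6 : c3.mem E = c.mem E + c1.mem bv := by
      rw [hf3.mem _ (by decide)]; simp [Config.set_mem]
    have e7 : c3.mem bl = c1.mem bl := by
      rw [hf3.mem _ (by decide)]; simp [Config.set_mem]
    have e8 : c3.mem br = c1.mem br := by
      rw [hf3.mem _ (by decide)]; simp [Config.set_mem]
    have h9 := stackCode_lt hNQ (ps := (c1.mem bl, c1.mem br) :: rest) (by
      rintro q hq
      rcases List.mem_cons.1 hq with rfl | hq
      · exact ⟨h1.le, h1.le_length⟩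
      · exact hv q (by simp [hq]))
    simp only [pushBest, wp_assign, Expr.eval, Config.set_mem, reduceCtorEq, if_false, if_true,
      e5, e6, e7, e8, hK3, List.nil_append]
    exact ⟨h9.trans_le hM, _, _, h1, rfl, rfl⟩

/-- Level 0 is optimal: an offline occurrence of the character costs 0, and without one every
substring has distance at least 1, which the empty substring attains. -/
theorem wp_readLeaf (hp : Params off M Q₀ H) (hc : Consts off M Q₀ H c)
    (hK : c.mem K = stackCode Q₀ ps) (hv : Valid off.length ps) {a : Fin σ} {w : List (Fin σ)}
    (hs : c.stream = a :: w) (hE : c.mem E + 1 < M) (hM : Q₀ ^ (2 * (ps.length + 1)) ≤ M) :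
    WP off M readLeaf (fun c' => ∃ p e, Good off (factor 0) p [a] e ∧
      c'.mem K = stackCode Q₀ (p :: ps) ∧ c'.mem E = c.mem E + e ∧ c'.stream = w) c := by
  have hσ := hp.alphabet
  have h2 := hp.two_le
  have hQM := hp.base_le
  have hNQ : off.length + 1 < Q₀ := by have := hp.two_mul; omega
  have hn := hc.n
  have hcode : charCode (some a) < M := (charCode_le _).trans_lt hσ
  have hpush : ∀ p : ℕ × ℕ, p.1 ≤ p.2 → p.2 ≤ off.length → stackCode Q₀ (p :: ps) < M := by
    intro p h3 h4
    refine (stackCode_lt (show off.length < Q₀ by omega) (ps := p :: ps) ?_).trans_le hM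
    rintro q hq
    rcases List.mem_cons.1 hq with rfl | hq
    exacts [⟨h3, h4⟩, hv q hq]
  have hc0 : Config.LT M (⟨Function.update c.mem x (charCode (some a)), w⟩ : Config Reg σ) := by
    intro z
    simp only [Function.update_apply]
    split_ifs
    exacts [hcode, hc.lt z]
  simp only [readLeaf, Cmd.block, wp_seq, wp_read, wp_assign, Expr.eval, Config.set_mem,
    reduceCtorEq, if_false, hs, List.head?_cons, List.tail_cons, Function.update_apply, hn, if_true]
  refine ⟨by omega, by omega, hcode, ?_⟩
  have hc1 := ((hc0.set fl (show 0 < M by omega)).set fr (show off.length < M by omega)).set fx hcode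
  refine (wp_findChar hσ h2 hc1).imp hσ hc1 fun c2 hc2 hf2 ⟨h3, h4, h5⟩ => ?_
  simp only [Config.set_mem, reduceCtorEq, if_false, if_true, charCode_eq_iff, ne_eq] at h4 h5
  have e1 : c2.mem E = c.mem E := by
    rw [hf2.mem _ (by decide)]; simp [Config.set_mem]
  have e2 : c2.mem K = stackCode Q₀ ps := by
    rw [hf2.mem _ (by decide)]; simp [Config.set_mem, hK]
  have e3 : c2.mem Q = Q₀ := by
    rw [hf2.mem _ (by decide)]; simp [Config.set_mem, hc.Q]
  have e4 : c2.stream = w := hf2.stream rfl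
  have hEM := hc.lt E
  simp only [pushBest, wp_ite, wp_seq, wp_assign, Expr.eval, Config.set_mem, reduceCtorEq,
    if_false, if_true, e1, e2, e3]
  have hff : factor 0 = 1 := rfl
  refine ⟨fun h => ?_, fun h => ?_⟩
  · obtain ⟨h6, h7, h8⟩ := h4 (by omega)
    refine ⟨by omega, by omega, hpush (c2.mem fp, c2.mem fp + 1) (by simp) h7,
      (c2.mem fp, c2.mem fp + 1), 0, ⟨by simp, h7, ?_, by simp⟩, rfl, rfl, e4⟩
    rw [sub_succ off h8, ed_self]
  · have hmem : ∀ l r, r ≤ off.length → a ∉ sub off l r := by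
      intro l r hr ha
      obtain ⟨i, _, hi, hia⟩ := (mem_sub off).1 ha
      exact h5 h i (by omega) (by omega) hia
    refine ⟨by omega, by omega, hE, hpush (0, 0) le_rfl (by simp),
      (0, 0), 1, ⟨le_rfl, by simp, ?_, fun l r _ hr => ?_⟩, rfl, rfl, e4⟩
    · rw [ed_singleton_of_not_mem (hmem 0 0 (by simp))]
      simp [sub_self]
    · rw [ed_singleton_of_not_mem (hmem l r hr), hff, one_mul]
      exact le_max_right _ _

theorem wp_setup (hσ : σ < M) (hc : c.LT M)
    (hM : 4 * ((c.mem n + 2) * (c.mem n + 2)) < M) :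
    WP off M setup (fun c' => c'.mem Q = 4 * ((c.mem n + 2) * (c.mem n + 2)) ∧
      ∃ H, c'.mem P0 = 2 ^ H ∧ c.mem n * c.mem n ≤ 2 ^ H ∧
        2 ^ H ≤ 2 * (c.mem n * c.mem n) + 1) c := by
  have hsq : (c.mem n + 2) * (c.mem n + 2) = c.mem n * c.mem n + 4 * c.mem n + 4 := by ring
  simp only [setup, Cmd.block, wp_seq, wp_assign, Expr.eval]
  refine ⟨hM, by omega, ?_⟩
  have hc1 := (hc.set Q hM).set P0 (show 1 < M by omega)
  -- Doubling only below `n ^ 2` keeps the power below `2 * n ^ 2`; the `+ 1` covers `n = 0`, where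
  -- it is 1.
  refine wp_while hσ hc1 (fun m c' => m = c.mem n * c.mem n - c'.mem P0 ∧ ∃ H,
    c'.mem P0 = 2 ^ H ∧ 2 ^ H ≤ 2 * (c.mem n * c.mem n) + 1) ⟨rfl, 0, ?_⟩ ?_ ?_
  · simp [Config.set_mem]
  · rintro m c2 hc2 hf2 ⟨hm, H, h1, h2⟩ he
    have e1 : c2.mem n = c.mem n := by
      rw [hf2.mem _ (by decide)]; simp [Config.set_mem]
    simp only [Expr.eval, e1, h1] at he
    have h3 : 0 < 2 ^ H := by positivity
    simp only [wp_assign, Expr.eval, Config.set_mem, if_true, h1]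
    exact ⟨by omega, _, by omega, rfl, H + 1, by rw [pow_succ]; omega, by rw [pow_succ]; omega⟩
  · rintro m c2 hc2 hf2 ⟨hm, H, h1, h2⟩ he
    have e1 : c2.mem n = c.mem n := by
      rw [hf2.mem _ (by decide)]; simp [Config.set_mem]
    have e2 : c2.mem Q = 4 * ((c.mem n + 2) * (c.mem n + 2)) := by
      rw [hf2.mem _ (by decide)]; simp [Config.set_mem]
    simp only [Expr.eval, e1, h1] at he
    exact ⟨e2, H, h1, by omega, h2⟩

/-- `B` is the branching of the algorithm with `k` levels for strings of length `n`. -/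
structure IsBase (n k B : ℕ) : Prop where
  two_le : 2 ≤ B
  le_pow : n ≤ B ^ k
  minimal : B = 2 ∨ (B - 1) ^ k < n

theorem wp_chooseBase (hσ : σ < M) (hk : 1 ≤ k) (hkM : k < M) (hc : c.LT M)
    (hM : c.mem n + 2 < M) :
    WP off M (chooseBase k) (fun c' => IsBase (c.mem n) k (c'.mem B)) c := by
  simp only [chooseBase, Cmd.block, wp_seq, wp_assign, Expr.eval]
  refine ⟨by omega, by omega, ?_⟩
  have hc1 := (hc.set B (show 1 < M by omega)).set y (show 1 < M by omega)
  -- The test `n ≤ B ^ k` is made by dividing `n - 1` by `B` repeatedly, so the power is never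
  -- formed. `B = 1` is the state before the first candidate; a rejected `B` satisfies `B ≤ B ^ k <
  -- n`, which bounds the search.
  refine wp_while hσ hc1 (fun m c' => 1 ≤ c'.mem B ∧
    (c'.mem y ≠ 0 → m = c.mem n + 2 - c'.mem B ∧
      (c'.mem B = 1 ∨ c'.mem B ^ k < c.mem n)) ∧
    (c'.mem y = 0 → m = 0 ∧ IsBase (c.mem n) k (c'.mem B))) (m₀ := c.mem n + 1) ?_ ?_ ?_
  · simp [Config.set_mem]
  · rintro m c2 hc2 hf2 ⟨hB, h1, -⟩ he
    have e1 : c2.mem n = c.mem n := by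
      rw [hf2.mem _ (by simp [Cmd.writes])]; simp [Config.set_mem]
    obtain ⟨hm, hBk⟩ := h1 he
    have hle : ∀ b : ℕ, b ≤ b ^ k := fun b => Nat.le_self_pow (by omega) b
    have hBn : c2.mem B ≤ c.mem n + 1 := by
      rcases hBk with h | h
      · omega
      · have := hle (c2.mem B)
        omega
    simp only [wp_seq, wp_assign, Expr.eval, Config.set_mem, reduceCtorEq, if_false, e1]
    refine ⟨by omega, by omega, hkM, ?_⟩
    have hc3 := ((hc2.set B (show c2.mem B + 1 < M by omega)).set y
      (show c.mem n - 1 < M by omega)).set j hkM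
    refine wp_while hσ hc3 (fun m c' => m = c'.mem j ∧ m ≤ k ∧
      c'.mem y = (c.mem n - 1) / (c2.mem B + 1) ^ (k - m)) (m₀ := k) ?_ ?_ ?_
    · simp [Config.set_mem]
    · rintro i c4 hc4 hf4 ⟨hi, hik, hy⟩ he4
      have e2 : c4.mem B = c2.mem B + 1 := by
        rw [hf4.mem _ (by decide)]; simp [Config.set_mem]
      simp only [Expr.eval, ← hi] at he4
      have hyM : c4.mem y / (c2.mem B + 1) < M := (Nat.div_le_self _ _).trans_lt (hc4 y)
      have hjM := hc4 j
      simp only [wp_seq, wp_assign, Expr.eval, Config.set_mem, reduceCtorEq, if_false, if_true, e2]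
      refine ⟨hyM, by omega, i - 1, by omega, by omega, by omega, ?_⟩
      rw [hy, Nat.div_div_eq_div_mul, ← pow_succ]
      congr 2
      omega
    · rintro i c4 hc4 hf4 ⟨hi, hik, hy⟩ he4
      have e2 : c4.mem B = c2.mem B + 1 := by
        rw [hf4.mem _ (by decide)]; simp [Config.set_mem]
      simp only [Expr.eval, ← hi] at he4
      rw [he4, Nat.sub_zero] at hy
      have hpos : 0 < (c2.mem B + 1) ^ k := by positivity
      have hle' := hle (c2.mem B + 1)
      rw [e2, hy]
      by_cases h0 : (c.mem n - 1) / (c2.mem B + 1) ^ k = 0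
      · refine ⟨0, ?_, by omega, fun h => absurd h0 h, fun _ => ⟨rfl, ?_, ?_, ?_⟩⟩
        · omega
        · omega
        · rcases Nat.div_eq_zero_iff.1 h0 with h | h <;> omega
        · rcases hBk with h | h
          · left; omega
          · right; simpa using h
      · have h3 : (c2.mem B + 1) ^ k ≤ c.mem n - 1 := by
          by_contra h
          exact h0 (Nat.div_eq_of_lt (by omega))
        exact ⟨c.mem n + 2 - (c2.mem B + 1), by omega, by omega,
          fun _ => ⟨rfl, .inr (by omega)⟩, fun h => absurd h h0⟩
  · rintro m c2 hc2 hf2 ⟨hB, -, h1⟩ he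
    exact (h1 he).2

end Reg

/-! ### The main loop and the output. -/

namespace Reg

variable {σ : ℕ} {off on : List (Fin σ)} {M Q₀ H k B₀ : ℕ} {c c' : Config Reg σ}

/-- The bound `M` on the contents of the registers leaves room for the run of the algorithm with
`k` levels on strings of length `n`. -/
structure Room (n σ k M : ℕ) : Prop where
  alphabet : σ < M
  levels : k < M
  estimate : factor k * n + 4 * ((n + 2) * (n + 2)) < M
  frames : ∀ H, 2 ^ H ≤ 2 * (n * n) + 1 → (4 * ((n + 2) * (n + 2))) ^ (7 * H + 1) ≤ M
  stack : ∀ B, IsBase n k B → (4 * ((n + 2) * (n + 2))) ^ (2 * ((k + 1) * B)) ≤ M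

/-- The state between two rounds, when `t` characters have been read. -/
def Between (off on : List (Fin σ)) (B₀ Q₀ t : ℕ) (c : Config Reg σ) : Prop :=
  c.stream = on.drop t ∧ t ≤ off.length ∧ ∃ st, Stack off B₀ 0 st t (on.take t) (c.mem E) ∧
    c.mem K = stackCode Q₀ st

theorem mod_test {a b : ℕ} : 1 - a % b ≠ 0 ↔ a % b = 0 := by omega

/-- The stack behaves like a base-`B₀` counter of the characters read: a round increments it, and
each carry is a merge. -/
theorem wp_round (hp : Params off M Q₀ H) (hc : Consts off M Q₀ H c) (hbase : IsBase off.length k B₀)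
    (hon : on.length = off.length) (hB : c.mem B = B₀) (hcnt : c.mem cnt = B₀)
    (hE : factor k * off.length + 1 < M) (hM : Q₀ ^ (2 * ((k + 1) * B₀)) ≤ M)
    (hH : off.length * off.length ≤ 2 ^ H) {t₀ : ℕ} (ht : c.mem t = t₀) (htn : t₀ < off.length)
    (hb : Between off on B₀ Q₀ t₀ c) :
    WP off M round (fun c' => c'.mem t = t₀ + 1 ∧ Between off on B₀ Q₀ (t₀ + 1) c') c := by
  have hσ := hp.alphabet
  have hB2 := hbase.two_le
  obtain ⟨hs, -, st, hst, hK⟩ := hb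
  obtain ⟨a, ha⟩ : ∃ a, on[t₀]? = some a := ⟨_, List.getElem?_eq_getElem (by omega)⟩
  have htake : on.take (t₀ + 1) = on.take t₀ ++ [a] := by
    rw [List.take_add_one, ha, Option.toList_some]
  have hdrop : on.drop t₀ = a :: on.drop (t₀ + 1) := by
    obtain ⟨h, rfl⟩ := List.getElem?_eq_some_iff.1 ha
    exact List.drop_eq_getElem_cons h
  have htM : off.length < M := by have := hp.two_mul; have := hp.base_le; omega
  have hQpos : 1 ≤ Q₀ := by have := hp.two_mul; omega
  have hpowM : ∀ m, m ≤ (k + 1) * B₀ → Q₀ ^ (2 * m) ≤ M := fun m hm =>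
    (Nat.pow_le_pow_right hQpos (by omega)).trans hM
  have hrep := hst.rep hB2 (k := k) (by have := hbase.le_pow; simpa using (by omega : t₀ ≤ B₀ ^ k))
  have hE0 := hrep.le_mul_length
  have hfac : ∀ m, m ≤ off.length → factor k * m ≤ factor k * off.length := fun m hm =>
    Nat.mul_le_mul_left _ hm
  have hE1 := hfac (on.take t₀).length (by simp; omega)
  have hstlen : st.length + 1 ≤ (k + 1) * B₀ := by
    -- A dummy push, which represents the empty string at no cost, gives the length bound for the
    -- stack with one more entry.
    have h1 := hst.push (p := (0, 0)) (y := []) (e := 0)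
      ⟨le_rfl, by simp, by simp [sub_self, ed_self], by simp⟩
    obtain ⟨_, _, _, _, _, _, h1⟩ := h1
    exact h1.length_le hB2 (k := k) (by have := hbase.le_pow; omega)
  simp only [round, Cmd.block, wp_seq, wp_assign, Expr.eval]
  refine (wp_readLeaf (ps := st) hp hc hK hrep.valid (hs.trans hdrop) (by omega)
    (hpowM _ hstlen)).imp hσ hc.lt fun c1 hc1 hf1 ⟨p, e, hg, hK1, hE1', hs1⟩ => ?_
  have e1 : c1.mem t = t₀ := (hf1.mem _ (by decide)).trans ht
  have e2 : c1.mem B = B₀ := (hf1.mem _ (by decide)).trans hB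
  have e3 : c1.mem cnt = B₀ := (hf1.mem _ (by decide)).trans hcnt
  have hcon1 := hc.frame hc1 hf1
  obtain ⟨top, rest, y, z, e₁, e₂, hpend⟩ := hst.push hg
  rw [← htake, ← hE1'] at hpend
  simp only [Config.set_mem, if_true, e1]
  have hc2 := (hc1.set t (show t₀ + 1 < M by omega)).set q (show t₀ + 1 < M by omega)
  refine ⟨by omega, by omega, ?_⟩
  -- The carry has reached level `j`, and `q * B₀ ^ j = t₀ + 1` says that all lower digits are zero.
  refine wp_while hσ hc2 (fun m c' => m = c'.mem q ∧ ∃ j st top rest y z e e',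
    Pending off B₀ j st (c'.mem q) (on.take (t₀ + 1)) (c'.mem E) top rest y z e e' ∧
      c'.mem q * B₀ ^ j = t₀ + 1 ∧ c'.mem K = stackCode Q₀ st) ⟨rfl, 0, p :: st, top, rest,
        y, z, e₁, e₂, ?_⟩ ?_ ?_
  · simpa [Config.set_mem] using ⟨hpend, hK1⟩
  · rintro m c3 hc3 hf3 ⟨hm, j, st', top, rest, y, z, e, e', hpend, hq, hK3⟩ he
    have hcon3 : Consts off M Q₀ H c3 := Consts.frame
      ⟨hc2, by simp [Config.set_mem, hcon1.n], by simp [Config.set_mem, hcon1.Q],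
        by simp [Config.set_mem, hcon1.P0]⟩ hc3 hf3
    have e4 : c3.mem B = B₀ := by rw [hf3.mem _ (by decide)]; simp [Config.set_mem, e2]
    have e5 : c3.mem cnt = B₀ := by rw [hf3.mem _ (by decide)]; simp [Config.set_mem, e3]
    simp only [Expr.eval, eval_modE, e4, mod_test] at he
    have htop := hpend.length_top hB2 he
    have hqn : c3.mem q ≤ off.length := by
      have := Nat.le_mul_of_pos_right (c3.mem q) (show 0 < B₀ ^ j by positivity)
      omega
    -- A merge happens only if `B₀ ≤ n`. The `B₀` substrings then have total length at most `n ^ 2 ≤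
    -- 2 ^ H`, as the evaluation needs.
    have hBn : B₀ ≤ off.length := (Nat.le_of_dvd hpend.pos (Nat.dvd_of_mod_eq_zero he)).trans hqn
    have hlen := hpend.length_le hB2 (k := k) (hqn.trans hbase.le_pow)
    have hstr := hpend.rep.length_str_le
    rw [htop] at hstr
    have hstr2 := Nat.mul_le_mul_right off.length hBn
    have hdiv : c3.mem q / B₀ * B₀ = c3.mem q := Nat.div_mul_cancel (Nat.dvd_of_mod_eq_zero he)
    have hall := hpend.rep_all hB2 (k := k) (by have := hbase.le_pow; omega)
    have hqj : c3.mem q / B₀ * B₀ ^ (j + 1) = t₀ + 1 := by rw [pow_succ', ← mul_assoc, hdiv, hq]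
    -- The increased estimate again belongs to a representation of the prefix read so far, so it is
    -- at most `factor k * n`.
    have hEs : ∀ p v, IsNearest off (str off top) p v → c3.mem E + v < M := by
      intro p v hn
      obtain ⟨_, _, _, _, _, _, h1⟩ := hpend.carry hB2 he hn
      have h2 := (h1.rep_all hB2 (k := k) (by have := hbase.le_pow; omega)).le_mul_length
      have h3 := hfac (on.take (t₀ + 1)).length (by simp; omega)
      omega
    have hst3 := hpend.stack_eq
    rw [hst3] at hall hK3 hlen
    rw [List.length_append] at hlen
    simp only [wp_seq, wp_assign, Expr.eval]
    refine (wp_mergeTop hp hcon3 hK3 (e4.trans htop.symm) (e5.trans htop.symm) hall.valid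
      (by omega) hEs (hpowM _ (by omega))).imp hσ hc3 fun c4 hc4 hf4 ⟨p', v', hn, hK4, hE4⟩ => ?_
    have e6 : c4.mem q = c3.mem q := hf4.mem _ (by decide)
    have e7 : c4.mem B = B₀ := (hf4.mem _ (by decide)).trans e4
    obtain ⟨top', rest', y', z', e₁', e₂', h1⟩ := hpend.carry hB2 he hn
    rw [← hE4] at h1
    simp only [Config.set_mem, reduceCtorEq, if_false, if_true, e6, e7]
    have hlt : c3.mem q / B₀ < c3.mem q := Nat.div_lt_self hpend.pos (by omega)
    have hqM := hc3 q
    exact ⟨by omega, _, by omega, rfl, j + 1, _, _, _, _, _, _, _, h1, hqj, hK4⟩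
  · rintro m c3 hc3 hf3 ⟨hm, j, st', top, rest, y, z, e, e', hpend, hq, hK3⟩ he
    have e4 : c3.mem B = B₀ := by rw [hf3.mem _ (by decide)]; simp [Config.set_mem, e2]
    have e5 : c3.mem t = t₀ + 1 := by rw [hf3.mem _ (by decide)]; simp [Config.set_mem]
    have e6 : c3.stream = on.drop (t₀ + 1) := (hf3.stream rfl).trans hs1
    simp only [Expr.eval, eval_modE, e4] at he
    have h1 := (hpend.toStack (by omega)).shift_zero (by omega)
    rw [hq] at h1
    exact ⟨e5, e6, htn, st', h1, hK3⟩

theorem wp_main (hk : 1 ≤ k) (hroom : Room off.length σ k M) (hon : on.length = off.length)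
    (hc : c.LT M) (hn : c.mem n = off.length) (hE : c.mem E = 0) (hK : c.mem K = 0)
    (hs : c.stream = on) :
    WP off M (main k) (fun c' => ed off on ≤ c'.mem E ∧
      c'.mem E ≤ (2 * factor k + 1) * ed off on) c := by
  have hσ := hroom.alphabet
  have hest := hroom.estimate
  have hsq : (off.length + 2) * (off.length + 2) =
    off.length * off.length + 4 * off.length + 4 := by ring
  simp only [main, Cmd.block, wp_seq, wp_assign, Expr.eval]
  refine (wp_chooseBase hσ hk hroom.levels hc (by rw [hn]; omega)).imp hσ hc
    fun c1 hc1 hf1 hbase => ?_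
  rw [hn] at hbase
  generalize hB₀ : c1.mem B = B₀ at hbase
  have a1 : c1.mem n = off.length := (hf1.mem _ (by simp [chooseBase, Cmd.block, Cmd.writes])).trans hn
  have a2 : c1.mem E = 0 := (hf1.mem _ (by simp [chooseBase, Cmd.block, Cmd.writes])).trans hE
  have a3 : c1.mem K = 0 := (hf1.mem _ (by simp [chooseBase, Cmd.block, Cmd.writes])).trans hK
  have a4 : c1.stream = on := (hf1.stream (by simp [chooseBase, Cmd.block, Cmd.reads])).trans hs
  refine (wp_setup hσ hc1 (by rw [a1]; omega)).imp hσ hc1 fun c2 hc2 hf2 ⟨hQ, H, hP0, hH, hH'⟩ => ?_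
  rw [a1] at hQ hH hH'
  generalize hQ₀ : 4 * ((off.length + 2) * (off.length + 2)) = Q₀ at hQ
  have hB2 : c2.mem B = B₀ := (hf2.mem _ (by decide)).trans hB₀
  have hp : Params off M Q₀ H := by
    refine ⟨hσ, by omega, by omega, by omega, ?_⟩
    rw [← hQ₀]
    exact hroom.frames H hH'
  have hcon2 : Consts off M Q₀ H c2 := ⟨hc2, (hf2.mem _ (by decide)).trans a1, hQ, hP0⟩
  have b2 : c2.mem E = 0 := (hf2.mem _ (by decide)).trans a2
  have b3 : c2.mem K = 0 := (hf2.mem _ (by decide)).trans a3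
  have b4 : c2.stream = on := (hf2.stream rfl).trans a4
  have hB₀M : B₀ < M := hB₀ ▸ hc1 B
  rw [hB2]
  refine ⟨hB₀M, by omega, ?_⟩
  have hc3 := (hc2.set cnt hB₀M).set t (show 0 < M by omega)
  have hstack := hroom.stack B₀ hbase
  rw [hQ₀] at hstack
  refine (wp_while (Q := fun c' => Between off on B₀ Q₀ off.length c' ∧ Consts off M Q₀ H c') hσ hc3
    (fun m c' => m + c'.mem t = off.length ∧ Between off on B₀ Q₀ (c'.mem t) c')
    (m₀ := off.length) ?_ ?_ ?_).imp hσ hc3 fun c4 hc4 hf4 ⟨hbetw, hcon4⟩ => ?_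
  · refine ⟨by simp [Config.set_mem], b4.trans (by simp [Config.set_mem]), by simp [Config.set_mem],
      [], ?_, by simp [Config.set_mem, b3, stackCode]⟩
    simpa [Config.set_mem, b2] using Stack.empty (s := off) (B := B₀) 0
  · rintro m c4 hc4 hf4 ⟨hm, hbetw⟩ he
    have hcon4 : Consts off M Q₀ H c4 := Consts.frame
      ⟨hc3, by simp [Config.set_mem, hcon2.n], by simp [Config.set_mem, hcon2.Q],
        by simp [Config.set_mem, hcon2.P0]⟩ hc4 hf4
    have d1 : c4.mem B = B₀ := by rw [hf4.mem _ (by decide)]; simp [Config.set_mem, hB2]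
    have d2 : c4.mem cnt = B₀ := by rw [hf4.mem _ (by decide)]; simp [Config.set_mem]
    simp only [Expr.eval, hcon4.n] at he
    refine (wp_round hp hcon4 hbase hon d1 d2 (by omega) hstack hH rfl (by omega) hbetw).imp
      hσ hc4 fun c5 hc5 hf5 ⟨ht, hb5⟩ => ⟨m - 1, by omega, by omega, by rwa [ht]⟩
  · rintro m c4 hc4 hf4 ⟨hm, hbetw⟩ he
    have hcon4 : Consts off M Q₀ H c4 := Consts.frame
      ⟨hc3, by simp [Config.set_mem, hcon2.n], by simp [Config.set_mem, hcon2.Q],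
        by simp [Config.set_mem, hcon2.P0]⟩ hc4 hf4
    simp only [Expr.eval, hcon4.n] at he
    rw [show c4.mem t = off.length by omega] at hbetw
    exact ⟨hbetw, hcon4⟩
  · obtain ⟨-, -, st, hst, hK4⟩ := hbetw
    rw [← hon, List.take_length] at hst
    have hrep := hst.rep hbase.two_le (k := k) (by
      have := hbase.le_pow
      simpa using (by omega : on.length ≤ B₀ ^ k))
    have hlen := hst.length_le hbase.two_le
    have hstr := hrep.length_str_le
    have hstr2 := Nat.mul_le_mul_right off.length (hlen.trans hon.le)
    have hnM : off.length < M := by omega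
    -- The count `n` selects the entire stack, which has at most one entry per character read.
    have htk : st.take off.length = st := List.take_of_length_le (by omega)
    have hn4 := hcon4.n
    simp only [hn4, Config.set_mem, reduceCtorEq, if_false]
    refine ⟨hnM, by omega, hnM, ?_⟩
    have hc5 := ((hc4.set cnt hnM).set l (show 0 < M by omega)).set r hnM
    refine (wp_evalDist (k := off.length) (ps := st) hp
      ⟨hc5, by simp [Config.set_mem, hcon4.Q], by simp [Config.set_mem, hK4],
        by simp [Config.set_mem]⟩ (by simp [Config.set_mem, hcon4.P0]) hrep.valid
      (by simp [Config.set_mem]) (by simp [Config.set_mem])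
      (by rw [htk]; omega)).imp hσ hc5 fun c6 hc6 hf6 hv => ?_
    simp only [Config.set_mem, reduceCtorEq, if_false, if_true, htk, sub_zero_length] at hv
    have e1 : c6.mem E = c4.mem E := by
      rw [hf6.mem _ (by decide)]; simp [Config.set_mem]
    -- With `W = str off st` and `D = ed off on`: `D ≤ ed off W + E`, while `ed off W ≤ D + E` and
    -- `E ≤ factor k * D`, so the output is at most `(2 * factor k + 1) * D`.
    have h1 := hrep.ed_le
    have h2 := hrep.opt 0 off.length (by simp) le_rfl
    rw [sub_zero_length] at h2
    have h3 := ed_triangle off on (str off st)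
    have h4 := ed_triangle off (str off st) on
    have h5 := ed_le_length_add off (str off st)
    have h6 := hrep.le_mul_length
    rw [ed_comm on] at h3
    rw [hon] at h6
    have hmul : (2 * factor k + 1) * ed off on = 2 * (factor k * ed off on) + ed off on := by ring
    rw [e1, hv, hmul, if_pos trivial]
    have := hp.add_pow
    exact ⟨by omega, by omega, by omega⟩

end Reg

/-! ### Size of the registers. -/

namespace Reg

/-- A base-`Q` digit has at most `2 * lam + 4` bits. The recursion depth is at most `2 * lam + 1`,
so the call stack needs at most `14 * lam + 8` digits; the stack of substrings needs two per entry.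
The other summands cover `E`, `k` and the alphabet. -/
theorem room_of_le {n σ k β w lam ℓ : ℕ} (hlam : n < 2 ^ lam) (hw : σ < 2 ^ w)
    (hβ : ∀ B, IsBase n k B → B ≤ β)
    (hℓ : (2 * lam + 4) * (14 * lam + 8) + (2 * lam + 4) * (2 * ((k + 1) * β)) + k +
      (2 * lam + 6) + w ≤ ℓ) : Room n σ k (2 ^ ℓ) := by
  have hpow : ∀ {i}, i ≤ ℓ → 2 ^ i ≤ 2 ^ ℓ := fun h => Nat.pow_le_pow_right (by omega) h
  have hn2 : n + 2 ≤ 2 ^ (lam + 1) := by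
    have : 0 < 2 ^ lam := by positivity
    rw [pow_succ]
    omega
  have hQ : 4 * ((n + 2) * (n + 2)) ≤ 2 ^ (2 * lam + 4) := by
    have h := Nat.mul_le_mul hn2 hn2
    have h4 : 2 ^ (2 * lam + 4) = 4 * (2 ^ (lam + 1) * 2 ^ (lam + 1)) := by ring
    omega
  have hQpow : ∀ i, (2 * lam + 4) * i ≤ ℓ → (4 * ((n + 2) * (n + 2))) ^ i ≤ 2 ^ ℓ := by
    intro i hi
    refine (Nat.pow_le_pow_left hQ i).trans ?_
    rw [← pow_mul]
    exact hpow hi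
  refine ⟨hw.trans_le (hpow (by omega)), Nat.lt_two_pow_self.trans_le (hpow (by omega)), ?_,
    fun H hH => hQpow _ ?_, fun B hB => hQpow _ ?_⟩
  · have h1 : factor k * n ≤ 2 ^ (k + 1) * 2 ^ lam :=
      Nat.mul_le_mul (Nat.sub_le _ _) hlam.le
    have h2 : 2 ^ (k + 1) * 2 ^ lam ≤ 2 ^ (k + 2 * lam + 4) := by
      rw [← pow_add]
      exact Nat.pow_le_pow_right (by omega) (by omega)
    have h3 : 2 ^ (2 * lam + 4) ≤ 2 ^ (k + 2 * lam + 4) :=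
      Nat.pow_le_pow_right (by omega) (by omega)
    have h4 : 2 ^ (k + 2 * lam + 6) = 4 * 2 ^ (k + 2 * lam + 4) := by ring
    have h5 := hpow (show k + 2 * lam + 6 ≤ ℓ by omega)
    have h6 : 0 < 2 ^ (k + 2 * lam + 4) := by positivity
    omega
  · have h1 : n * n < 2 ^ lam * 2 ^ lam := Nat.mul_lt_mul'' hlam hlam
    have h2 : 2 ^ (2 * lam + 1) = 2 * (2 ^ lam * 2 ^ lam) := by ring
    have h3 : H ≤ 2 * lam + 1 := (Nat.pow_le_pow_iff_right (a := 2) (by omega)).1 (by omega)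
    have h4 : (2 * lam + 4) * (7 * H + 1) ≤ (2 * lam + 4) * (14 * lam + 8) :=
      Nat.mul_le_mul_left _ (by omega)
    omega
  · have h4 : (2 * lam + 4) * (2 * ((k + 1) * B)) ≤ (2 * lam + 4) * (2 * ((k + 1) * β)) :=
      Nat.mul_le_mul_left _ (Nat.mul_le_mul_left _ (Nat.mul_le_mul_left _ (hβ B hB)))
    omega

/-- Six leaves occur in the formula for the cost in `leafCost`; apart from `k`, the largest constant
is 4. -/
theorem main_fits {k M : ℕ} (hM : 5 ≤ M) (hk : k < M) : (main k).Fits 6 M := by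
  have h : 0 < M ∧ 1 < M ∧ 2 < M ∧ 4 < M := by omega
  simp [main, chooseBase, setup, round, readLeaf, mergeTop, pushBest, nearest, evalDist, evalCond,
    evalStep, enter, resume, dispatch, popReg, pushReg, leafCost, charAt, findChar, modE,
    Cmd.block, Cmd.Fits, Expr.size, Expr.ConstLT, h, hk]

/-- The algorithm with `k` levels. -/
noncomputable def algorithm (k : ℕ) : Algorithm where
  V := Reg ⊕ Fin 7
  input := .inl n
  output := .inl E
  code := (main k).compile 6

theorem algorithm_returns {n σ k ℓ : ℕ} (hk : 1 ≤ k) (hroom : Room n σ k (2 ^ ℓ))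
    {off on : List (Fin σ)} (hoff : off.length = n) (hon : on.length = n) :
    ∃ d, (algorithm k).Returns n off on (Fintype.card (Reg ⊕ Fin 7) * (6 * ℓ)) d ∧
      ed off on ≤ d ∧ d ≤ (2 * factor k + 1) * ed off on := by
  subst hoff
  have hest := hroom.estimate
  have hsq : (off.length + 2) * (off.length + 2) =
    off.length * off.length + 4 * off.length + 4 := by ring
  let c₀ : Config Reg σ := ⟨Function.update (fun _ => 0) n off.length, on⟩
  have hc₀ : c₀.LT (2 ^ ℓ) := by
    intro z
    simp only [c₀, Function.update_apply]
    split_ifs <;> omega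
  obtain ⟨c, hb, h1, h2⟩ := wp_main (c := c₀) hk hroom hon hc₀ (by simp [c₀]) (by simp [c₀])
    (by simp [c₀]) rfl
  have hL : (2 ^ ℓ) ^ 6 = 2 ^ (6 * ℓ) := by rw [← pow_mul, mul_comm]
  have hle : 2 ^ ℓ ≤ 2 ^ (6 * ℓ) := Nat.pow_le_pow_right (by omega) (by omega)
  let d₀ : Config (Reg ⊕ Fin (6 + 1)) σ :=
    ⟨Function.update (fun _ => 0) (.inl n) off.length, on⟩
  have hagree : Agree c₀ d₀ (2 ^ (6 * ℓ)) := by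
    refine ⟨fun z => ?_, rfl, fun z => ?_⟩
    · simp [c₀, d₀, Function.update_apply]
    · simp only [d₀, Function.update_apply]
      split_ifs <;> omega
  obtain ⟨d, hx, ha, -⟩ := hb.exec_compile (S := 6) (L := 6 * ℓ) (by omega) hroom.alphabet hL
    (by omega) (main_fits (by omega) hroom.levels) hc₀ _ hagree
  exact ⟨c.mem E, ⟨d, hx, ha.mem E⟩, h1, h2⟩

end Reg

/-! ### Real estimates for the memory. -/

section Bounds

/-- For `δ ≤ 1` the ceiling is at most `2 / δ` and its inverse at most `δ`. For `δ > 1` the ceiling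
is 1, and `δ ≤ 2 * x ^ (δ - 1)` follows from `exp t ≥ 1 + t` and `log x ≥ log 2 > 1 / 2`. -/
theorem levels_le {δ x : ℝ} (hδ : 0 < δ) (hx : 2 ≤ x) :
    (⌈1 / δ⌉₊ : ℝ) * x ^ (1 / (⌈1 / δ⌉₊ : ℝ)) ≤ 2 * (x ^ δ / δ) := by
  have hk : 1 / δ ≤ (⌈1 / δ⌉₊ : ℝ) := Nat.le_ceil _
  have hpos : 0 < 1 / δ := by positivity
  have hkpos : (0 : ℝ) < ⌈1 / δ⌉₊ := hpos.trans_le hk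
  rcases le_or_gt δ 1 with h1 | h1
  · have h2 : x ^ (1 / (⌈1 / δ⌉₊ : ℝ)) ≤ x ^ δ := by
      apply Real.rpow_le_rpow_of_exponent_le (by linarith)
      rw [one_div_le hkpos hδ]
      exact hk
    have h3 : (⌈1 / δ⌉₊ : ℝ) < 1 / δ + 1 := Nat.ceil_lt_add_one hpos.le
    have h4 : 1 ≤ 1 / δ := by rw [le_div_iff₀ hδ]; linarith
    have h5 : (0 : ℝ) < x ^ δ := Real.rpow_pos_of_pos (by linarith) _
    calc (⌈1 / δ⌉₊ : ℝ) * x ^ (1 / (⌈1 / δ⌉₊ : ℝ)) ≤ (2 * (1 / δ)) * x ^ δ := by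
          apply mul_le_mul (by linarith) h2 (by positivity) (by linarith)
      _ = _ := by ring
  · have h2 : ⌈1 / δ⌉₊ = 1 := by
      rw [Nat.ceil_eq_iff (by norm_num)]
      constructor
      · simpa using hδ
      · rw [div_le_iff₀ hδ]
        simpa using h1.le
    have h3 : x ^ δ = x * x ^ (δ - 1) := by
      rw [Real.rpow_sub_one (by linarith)]
      field_simp
    have h4 : Real.log 2 ≤ Real.log x := Real.log_le_log (by norm_num) hx
    have h5 := Real.log_two_gt_d9
    have h6 : 1 + (δ - 1) / 2 ≤ x ^ (δ - 1) := by
      rw [Real.rpow_def_of_pos (by linarith)]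
      have h7 := Real.add_one_le_exp (Real.log x * (δ - 1))
      nlinarith
    rw [h2, h3]
    simp only [Nat.cast_one, div_one, Real.rpow_one, one_mul]
    rw [← mul_div_assoc, le_div_iff₀ hδ]
    nlinarith

theorem base_le {n k B : ℕ} (hk : 1 ≤ k) (h : Reg.IsBase n k B) :
    B ≤ ⌊(n : ℝ) ^ (1 / (k : ℝ))⌋₊ + 2 := by
  rcases h.minimal with h1 | h1
  · omega
  · have h2 : B - 1 ≤ ⌊(n : ℝ) ^ (1 / (k : ℝ))⌋₊ := by
      apply Nat.le_floor
      rw [← Real.pow_rpow_inv_natCast (Nat.cast_nonneg (B - 1)) (show k ≠ 0 by omega), one_div]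
      exact Real.rpow_le_rpow (by positivity) (by exact_mod_cast h1.le) (by positivity)
    omega

theorem size_le_log {n : ℕ} (hn : 2 ≤ n) : (Nat.size n : ℝ) ≤ 3 * Real.log n := by
  have h1 : 2 ^ (Nat.size n - 1) ≤ n := by
    by_contra h
    have := Nat.size_le.2 (not_le.1 h)
    have := Nat.size_pos.2 (show 0 < n by omega)
    omega
  have h2 : (Nat.size n - 1 : ℕ) * Real.log 2 ≤ Real.log n := by
    rw [← Real.log_pow]
    exact Real.log_le_log (by positivity) (by exact_mod_cast h1)
  have h3 : Real.log 2 ≤ Real.log n := Real.log_le_log (by norm_num) (by exact_mod_cast hn)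
  have h4 := Real.log_two_gt_d9
  have h5 : 1 ≤ Nat.size n := Nat.size_pos.2 (by omega)
  rw [Nat.cast_sub h5] at h2
  push_cast at h2
  nlinarith

theorem size_le_logb (σ : ℕ) (hσ : 1 ≤ σ) : (Nat.size σ : ℝ) ≤ 2 * Real.logb 2 ((σ : ℝ) + 1) := by
  have h1 : 2 ^ (Nat.size σ - 1) ≤ σ := by
    by_contra h
    have := Nat.size_le.2 (not_le.1 h)
    have := Nat.size_pos.2 (show 0 < σ by omega)
    omega
  have h5 : 1 ≤ Nat.size σ := Nat.size_pos.2 (by omega)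
  have h2 : ((Nat.size σ - 1 : ℕ) : ℝ) ≤ Real.logb 2 ((σ : ℝ) + 1) := by
    rw [Real.le_logb_iff_rpow_le (by norm_num) (by positivity), Real.rpow_natCast]
    exact_mod_cast h1.trans (Nat.le_succ σ)
  have h3 : 1 ≤ Real.logb 2 ((σ : ℝ) + 1) := by
    rw [Real.le_logb_iff_rpow_le (by norm_num) (by positivity), Real.rpow_one]
    have : (1 : ℝ) ≤ σ := by exact_mod_cast hσ
    linarith
  rw [Nat.cast_sub h5] at h2
  push_cast at h2
  linarith

/-- Here `F`, `x`, `s` stand for `n ^ δ / δ`, `log n` and `logb 2 (σ + 1)`. All three are bounded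
below by positive constants, so every summand is absorbed by the product `F * x ^ 2 * s`. -/
theorem memory_le {F x s lam k β w : ℝ} (hx : 2 / 3 ≤ x) (hs : 1 ≤ s) (hlam : lam ≤ 3 * x)
    (hlam0 : 0 ≤ lam) (hk1 : 1 ≤ k) (hk : k ≤ 2 * F) (hβ : k * β ≤ 6 * F) (hβ0 : 0 ≤ β)
    (hw : w ≤ 2 * s) :
    (2 * lam + 4) * (14 * lam + 8) + (2 * lam + 4) * (2 * ((k + 1) * β)) + k +
      (2 * lam + 6) + w ≤ 2000 * (F * x ^ 2 * s) := by
  have hF : 1 / 2 ≤ F := by linarith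
  have a1 : 2 * lam + 4 ≤ 12 * x := by linarith
  have a2 : 14 * lam + 8 ≤ 54 * x := by linarith
  have a3 : 2 * ((k + 1) * β) ≤ 24 * F := by nlinarith
  have b1 : (2 * lam + 4) * (14 * lam + 8) ≤ 12 * x * (54 * x) :=
    mul_le_mul a1 a2 (by linarith) (by linarith)
  have b2 : (2 * lam + 4) * (2 * ((k + 1) * β)) ≤ 12 * x * (24 * F) :=
    mul_le_mul a1 a3 (by positivity) (by linarith)
  have hx2 : 2 / 3 * x ≤ x ^ 2 := by nlinarith
  have hx1 : 4 / 9 ≤ x ^ 2 := by nlinarith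
  have hFs : 1 / 2 ≤ F * s := by nlinarith
  have c0 : F ≤ F * s := by nlinarith
  have c1 : x ^ 2 ≤ 2 * (F * x ^ 2 * s) := by nlinarith
  have c2 : F * x ≤ 3 / 2 * (F * x ^ 2 * s) := by
    have : F * x ≤ F * s * x := mul_le_mul_of_nonneg_right c0 (by linarith)
    nlinarith
  have c3 : F ≤ 9 / 4 * (F * x ^ 2 * s) := by nlinarith
  have c4 : x ≤ 3 * (F * x ^ 2 * s) := by nlinarith
  have c5 : s ≤ 9 / 2 * (F * x ^ 2 * s) := by
    have h1 : s ≤ 2 * (F * s) := by nlinarith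
    have h2 : F * s ≤ 9 / 4 * (F * s * x ^ 2) := by nlinarith
    nlinarith
  have c6 : 1 ≤ s := hs
  nlinarith

end Bounds

end AsymStream

/-- Approximation of the edit distance in the asymmetric streaming model. -/
theorem theorem1 :
    ∃ (K₁ K₂ : ℝ) (e : ℕ), ∀ δ : ℝ, 0 < δ →
      ∃ A : AsymStream.Algorithm,
        ∀ (n σ : ℕ) (offline online : List (Fin σ)),
          offline.length = n → online.length = n →
          ∃ b d : ℕ,
            A.Returns n offline online b d ∧
            AsymStream.ed offline online ≤ d ∧
            (d : ℝ) ≤ K₁ * (2 : ℝ) ^ (1 / δ) * (AsymStream.ed offline online : ℝ) ∧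
            (2 ≤ n →
              (b : ℝ) ≤ K₂ * ((n : ℝ) ^ δ / δ) * Real.log (n : ℝ) ^ e
                * Real.logb 2 ((σ : ℝ) + 1)) := by
  -- `8` comes from `2 ^ (k + 2)` with `k ≤ 1 / δ + 1`. In the second constant, each register has at
  -- most `6 * ℓ` bits, and `2000` is the constant of `memory_le`.
  refine ⟨8, Fintype.card (AsymStream.Reg ⊕ Fin 7) * (6 * 2000), 2, fun δ hδ =>
    ⟨AsymStream.Reg.algorithm ⌈1 / δ⌉₊, fun n σ offline online hoff hon => ?_⟩⟩
  set k := ⌈1 / δ⌉₊ with hkdef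
  have hpos : 0 < 1 / δ := by positivity
  have hk : 1 ≤ k := Nat.ceil_pos.2 hpos
  set β := ⌊(n : ℝ) ^ (1 / (k : ℝ))⌋₊ + 2 with hβ
  set ℓ := (2 * n.size + 4) * (14 * n.size + 8) + (2 * n.size + 4) * (2 * ((k + 1) * β)) + k +
    (2 * n.size + 6) + σ.size with hℓ
  have hroom : AsymStream.Reg.Room n σ k (2 ^ ℓ) :=
    AsymStream.Reg.room_of_le (Nat.lt_size_self n) (Nat.lt_size_self σ)
      (fun B hB => AsymStream.base_le hk hB) le_rfl
  obtain ⟨d, hret, h1, h2⟩ := AsymStream.Reg.algorithm_returns hk hroom hoff hon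
  refine ⟨_, d, hret, h1, ?_, fun hn => ?_⟩
  · have h3 : (2 * AsymStream.factor k + 1 : ℕ) ≤ (2 : ℝ) ^ (k + 2) := by
      rw [← AsymStream.factor_succ, AsymStream.factor]
      exact_mod_cast Nat.sub_le _ _
    have h4 : (2 : ℝ) ^ (k + 2) ≤ 8 * (2 : ℝ) ^ (1 / δ) := by
      have h5 : (k : ℝ) ≤ 1 / δ + 1 := (Nat.ceil_lt_add_one hpos.le).le
      have h6 := Real.rpow_le_rpow_of_exponent_le (show (1 : ℝ) ≤ 2 by norm_num) h5
      rw [Real.rpow_natCast, Real.rpow_add_one (by norm_num)] at h6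
      rw [pow_add]
      linarith
    calc (d : ℝ) ≤ ((2 * AsymStream.factor k + 1) * AsymStream.ed offline online : ℕ) := by
          exact_mod_cast h2
      _ ≤ _ := by
          rw [Nat.cast_mul]
          exact mul_le_mul_of_nonneg_right (h3.trans h4) (Nat.cast_nonneg _)
  · have hn' : (2 : ℝ) ≤ n := by exact_mod_cast hn
    -- A nonempty string forces a nonempty alphabet; for `σ = 0` the factor `logb 2 (σ + 1)` would
    -- vanish.
    have hσ : 1 ≤ σ := by
      rcases Nat.eq_zero_or_pos σ with rfl | h
      · cases offline with
        | nil => simp at hoff; omega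
        | cons a _ => exact a.elim0
      · exact h
    have hlev := AsymStream.levels_le hδ hn'
    rw [← hkdef] at hlev
    have hk' : (1 : ℝ) ≤ k := by exact_mod_cast hk
    have hroot : (1 : ℝ) ≤ (n : ℝ) ^ (1 / (k : ℝ)) :=
      Real.one_le_rpow (by linarith) (by positivity)
    have hβ' : (β : ℝ) ≤ 3 * (n : ℝ) ^ (1 / (k : ℝ)) := by
      have := Nat.floor_le (show 0 ≤ (n : ℝ) ^ (1 / (k : ℝ)) by linarith)
      rw [hβ]
      push_cast
      linarith
    have hlog : 2 / 3 ≤ Real.log n := by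
      have h3 : Real.log 2 ≤ Real.log n := Real.log_le_log (by norm_num) hn'
      have := Real.log_two_gt_d9
      linarith
    have hlogb : 1 ≤ Real.logb 2 ((σ : ℝ) + 1) := by
      rw [Real.le_logb_iff_rpow_le (by norm_num) (by positivity), Real.rpow_one]
      have : (1 : ℝ) ≤ σ := by exact_mod_cast hσ
      linarith
    have hmem := AsymStream.memory_le (F := (n : ℝ) ^ δ / δ) hlog hlogb
      (AsymStream.size_le_log hn) (Nat.cast_nonneg _) hk' (by nlinarith) (by nlinarith)
      (Nat.cast_nonneg β) (AsymStream.size_le_logb σ hσ)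
    have hℓ' : (ℓ : ℝ) ≤ 2000 * ((n : ℝ) ^ δ / δ * Real.log n ^ 2 *
        Real.logb 2 ((σ : ℝ) + 1)) := by
      rw [hℓ]
      push_cast
      exact hmem
    rw [Nat.cast_mul, Nat.cast_mul]
    calc _ ≤ (Fintype.card (AsymStream.Reg ⊕ Fin 7) : ℝ) * ((6 : ℕ) *
          (2000 * ((n : ℝ) ^ δ / δ * Real.log n ^ 2 * Real.logb 2 ((σ : ℝ) + 1)))) := by gcongr
      _ = _ := by push_cast; ring
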